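/- Let $R$ be an associative ring with identity; modules are left $R$-modules unless stated otherwise. A module is super finitely presented if it has a projective resolution by finitely generated projective modules. A module $W$ is weak injective if $\operatorname{Ext}^1_R(S,W)=0$ for every super finitely presented module $S$, and weak flat if $\operatorname{Tor}_1^R(S,W)=0$ for every super finitely presented right module $S$. A module $M$ is Gorenstein weak injective (in $\mathcal{GWI}$) if there is an exact sequence $\cdots\to I_1\to I_0\to I^0\to I^1\to\cdots$ of injective modules with $M\cong\operatorname{Coker}(I_1\to I_0)$ that stays exact under $\operatorname{Hom}_R(W,-)$ for every weak injective $W$. It is Gorenstein weak projective (in $\mathcal{GWP}$) if there is an exact sequence $\cdots\to P_1\to P_0\to P^0\to P^1\to\cdots$ of projective modules with $M\cong\operatorname{Coker}(P_1\to P_0)$ that stays exact under $\operatorname{Hom}_R(-,W)$ for every weak flat $W$. $\operatorname{Gwid}_R(N)$ is the infimum of the $n\ge 0$ for which there is an exact sequence $0\to N\to G^0\to\cdots\to G^n\to 0$ with all $G^i\in\mathcal{GWI}$, and $\operatorname{Gwpd}_R(M)$ is the infimum of the $n\ge 0$ for which there is an exact sequence $0\to G_n\to\cdots\to G_0\to M\to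 0$ with all $G_i\in\mathcal{GWP}$ (each is $\infty$ if there is no such $n$). A proper right $\mathcal{GWI}$-resolution of $N$ is a complex $0\to N\to G^0\to G^1\to\cdots$ with all $G^i\in\mathcal{GWI}$ that becomes exact under $\operatorname{Hom}_R(-,X)$ for every $X\in\mathcal{GWI}$. A proper left $\mathcal{GWP}$-resolution of $M$ is a complex $\cdots\to G_1\to G_0\to M\to 0$ with all $G_i\in\mathcal{GWP}$ that becomes exact under $\operatorname{Hom}_R(X,-)$ for every $X\in\mathcal{GWP}$. Put $$\operatorname{Ext}^n_{\mathcal{GWI}}(M,N)=H^n(\operatorname{Hom}_R(M,G^\bullet)),\qquad \operatorname{Ext}^n_{\mathcal{GWP}}(M,N)=H^n(\operatorname{Hom}_R(G_\bullet,N)),$$ where $G^\bullet$ is a proper right $\mathcal{GWI}$-resolution of $N$ and $G_\bullet$ is a proper left $\mathcal{GWP}$-resolution of $M$; morphisms of modules act through lifts to chain maps of the resolutions, which exist and are unique up to homotopy. Theorem. Every module $M$ with $\operatorname{Gwpd}_R(M)<\infty$ has a proper left $\mathcal{GWP}$-resolution, and every module $N$ with $\operatorname{Gwid}_R(N)<\infty$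 has a proper right $\mathcal{GWI}$-resolution. For all such $M$ and $N$, any choice of these resolutions, and every $n\ge 0$, there are isomorphisms of abelian groups $$\operatorname{Ext}^n_{\mathcal{GWI}}(M,N)\cong\operatorname{Ext}^n_{\mathcal{GWP}}(M,N)$$ which are functorial in $M$ and $N$. -/

import Mathlib

universe u v w

open CategoryTheory Limits Opposite

noncomputable section

namespace GorensteinWeak

/-! ### Hom complexes -/

section HomComplex

variable {C : Type w} [Category.{v} C] [Abelian C] {ι : Type} {c : ComplexShape ι}

/-- The complex of abelian groups `Hom(X, K)`. -/
abbrev homFrom (X : C) (K : HomologicalComplex C c) : HomologicalComplex AddCommGrpCat.{v} c :=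
  ((preadditiveCoyoneda.obj (op X)).mapHomologicalComplex c).obj K

/-- The complex of abelian groups `Hom(K, X)`, with its arrows reversed. -/
abbrev homTo (K : HomologicalComplex C c) (X : C) :
    HomologicalComplex AddCommGrpCat.{v} c.symm :=
  ((preadditiveYoneda.obj X).mapHomologicalComplex c.symm).obj K.op

/-- `Hom(X, K) ⟶ Hom(X', L)`, induced by `f : X' ⟶ X` and `φ : K ⟶ L`. -/
def homFromMap {X X' : C} (f : X' ⟶ X) {K L : HomologicalComplex C c} (φ : K ⟶ L) :
    homFrom X K ⟶ homFrom X' L :=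
  (NatTrans.mapHomologicalComplex (preadditiveCoyoneda.map f.op) c).app K ≫
    ((preadditiveCoyoneda.obj (op X')).mapHomologicalComplex c).map φ

/-- `Hom(K, X) ⟶ Hom(L, X')`, induced by `φ : L ⟶ K` and `f : X ⟶ X'`. -/
def homToMap {K L : HomologicalComplex C c} (φ : L ⟶ K) {X X' : C} (f : X ⟶ X') :
    homTo K X ⟶ homTo L X' :=
  (NatTrans.mapHomologicalComplex (preadditiveYoneda.map f) c.symm).app K.op ≫
    ((preadditiveYoneda.obj X').mapHomologicalComplex c.symm).map
      ((HomologicalComplex.opFunctor C c).map φ.op)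

lemma homFromMap_id (X : C) (K : HomologicalComplex C c) :
    homFromMap (𝟙 X) (𝟙 K) = 𝟙 (homFrom X K) := by
  ext i x
  simp [homFromMap]

lemma homFromMap_comp {X X' X'' : C} (f : X' ⟶ X) (f' : X'' ⟶ X')
    {K L P : HomologicalComplex C c} (φ : K ⟶ L) (ψ : L ⟶ P) :
    homFromMap (f' ≫ f) (φ ≫ ψ) = homFromMap f φ ≫ homFromMap f' ψ := by
  ext i (x : X ⟶ K.X i)
  change ((f' ≫ f) ≫ x) ≫ φ.f i ≫ ψ.f i = (f' ≫ (f ≫ x) ≫ φ.f i) ≫ ψ.f i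
  simp only [Category.assoc]

lemma homToMap_id (X : C) (K : HomologicalComplex C c) :
    homToMap (𝟙 K) (𝟙 X) = 𝟙 (homTo K X) := by
  ext i (x : K.X i ⟶ X)
  change 𝟙 (K.X i) ≫ x ≫ 𝟙 X = x
  simp only [Category.id_comp, Category.comp_id]

lemma homToMap_comp {X X' X'' : C} (f : X ⟶ X') (f' : X' ⟶ X'')
    {K L P : HomologicalComplex C c} (φ : L ⟶ K) (ψ : P ⟶ L) :
    homToMap (ψ ≫ φ) (f ≫ f') = homToMap φ f ≫ homToMap ψ f' := by
  ext i (x : K.X i ⟶ X)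
  change (ψ.f i ≫ φ.f i) ≫ x ≫ f ≫ f' = ψ.f i ≫ (φ.f i ≫ x ≫ f) ≫ f'
  simp only [Category.assoc]

lemma homologyMap_homFromMap_eq {X X' : C} (f : X' ⟶ X) {K L : HomologicalComplex C c}
    {φ ψ : K ⟶ L} (h : Homotopy φ ψ) (n : ι) :
    HomologicalComplex.homologyMap (homFromMap f φ) n =
      HomologicalComplex.homologyMap (homFromMap f ψ) n := by
  simp only [homFromMap, HomologicalComplex.homologyMap_comp]
  rw [((preadditiveCoyoneda.obj (op X')).mapHomotopy h).homologyMap_eq]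

lemma homologyMap_homToMap_eq {K L : HomologicalComplex C c} {φ ψ : L ⟶ K}
    (h : Homotopy φ ψ) {X X' : C} (f : X ⟶ X') (n : ι) :
    HomologicalComplex.homologyMap (homToMap φ f) n =
      HomologicalComplex.homologyMap (homToMap ψ f) n := by
  simp only [homToMap, HomologicalComplex.homologyMap_comp]
  exact congrArg (_ ≫ ·) (((preadditiveYoneda.obj X').mapHomotopy h.op).homologyMap_eq n)

end HomComplex

/-! ### Proper resolutions with respect to a class of objects -/

section Resolutions

variable {C : Type w} [Category.{v} C] [Abelian C]

/-- A proper right `F`-resolution `0 ⟶ N ⟶ G⁰ ⟶ G¹ ⟶ ⋯` of `N`: a complex with all `Gⁱ` in `F`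
which stays exact under `Hom(-, X)` for all `X` in `F`. -/
structure ProperRightResolution (F : ObjectProperty C) (N : C) where
  /-- the complex `G⁰ ⟶ G¹ ⟶ ⋯` -/
  complex : CochainComplex C ℕ
  /-- the augmentation `N ⟶ G⁰` -/
  ι : N ⟶ complex.X 0
  ι_d : ι ≫ complex.d 0 1 = 0
  mem : ∀ i, F (complex.X i)
  proper : ∀ X, F X → (homTo (complex.augment ι ι_d) X).Acyclic

/-- A proper left `F`-resolution `⋯ ⟶ G₁ ⟶ G₀ ⟶ M ⟶ 0` of `M`: a complex with all `Gᵢ` in `F`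
which stays exact under `Hom(X, -)` for all `X` in `F`. -/
structure ProperLeftResolution (F : ObjectProperty C) (M : C) where
  /-- the complex `⋯ ⟶ G₁ ⟶ G₀` -/
  complex : ChainComplex C ℕ
  /-- the augmentation `G₀ ⟶ M` -/
  π : complex.X 0 ⟶ M
  d_π : complex.d 1 0 ≫ π = 0
  mem : ∀ i, F (complex.X i)
  proper : ∀ X, F X → (homFrom X (complex.augment π d_π)).Acyclic

variable {F : ObjectProperty C}

lemma exists_factor_of_homTo {K : CochainComplex C ℕ} {X : C} (h : (homTo K X).Acyclic) (j : ℕ)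
    (f : K.X j ⟶ X) (hf : ∀ i, i + 1 = j → K.d i j ≫ f = 0) :
    ∃ g : K.X (j + 1) ⟶ X, K.d j (j + 1) ≫ g = f := by
  have hj := h j
  rw [(homTo K X).exactAt_iff' (j + 1) j ((ComplexShape.up ℕ).prev j)
    ((ComplexShape.up ℕ).symm.prev_eq' rfl) rfl, ShortComplex.ab_exact_iff] at hj
  obtain ⟨g, hg⟩ := hj f (by
    by_cases hj : ∃ i, i + 1 = j
    · obtain ⟨i, rfl⟩ := hj
      exact hf _ (by simp)
    · change K.d _ _ ≫ f = 0
      rw [K.shape, zero_comp]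
      exact fun h => hj ⟨_, h⟩)
  exact ⟨g, hg⟩

lemma exists_factor_of_homFrom {K : ChainComplex C ℕ} {X : C} (h : (homFrom X K).Acyclic) (j : ℕ)
    (f : X ⟶ K.X j) (hf : ∀ i, i + 1 = j → f ≫ K.d j i = 0) :
    ∃ g : X ⟶ K.X (j + 1), g ≫ K.d (j + 1) j = f := by
  have hj := h j
  rw [(homFrom X K).exactAt_iff' (j + 1) j ((ComplexShape.down ℕ).next j)
    ((ComplexShape.down ℕ).prev_eq' rfl) rfl, ShortComplex.ab_exact_iff] at hj
  obtain ⟨g, hg⟩ := hj f (by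
    by_cases hj : ∃ i, i + 1 = j
    · obtain ⟨i, rfl⟩ := hj
      exact hf _ (by simp)
    · change f ≫ K.d _ _ = 0
      rw [K.shape, comp_zero]
      exact fun h => hj ⟨_, h⟩)
  exact ⟨g, hg⟩

namespace ProperRightResolution

variable {N N' N'' : C} (P : ProperRightResolution F N) (Q : ProperRightResolution F N')

lemma exists_factor_zero {X : C} (hX : F X) (f : N ⟶ X) :
    ∃ g : P.complex.X 0 ⟶ X, P.ι ≫ g = f :=
  exists_factor_of_homTo (P.proper X hX) 0 f (by simp)

lemma exists_factor_one {X : C} (hX : F X) (f : P.complex.X 0 ⟶ X) (hf : P.ι ≫ f = 0) :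
    ∃ g : P.complex.X 1 ⟶ X, P.complex.d 0 1 ≫ g = f :=
  exists_factor_of_homTo (P.proper X hX) 1 f (by
    intro i hi
    obtain rfl : i = 0 := by lia
    exact hf)

lemma exists_factor_succ {X : C} (hX : F X) (n : ℕ) (f : P.complex.X (n + 1) ⟶ X)
    (hf : P.complex.d n (n + 1) ≫ f = 0) :
    ∃ g : P.complex.X (n + 2) ⟶ X, P.complex.d (n + 1) (n + 2) ≫ g = f :=
  exists_factor_of_homTo (P.proper X hX) (n + 2) f (by
    intro i hi
    obtain rfl : i = n + 1 := by lia
    exact hf)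

/-- Every morphism lifts to a chain map of proper right resolutions. -/
lemma exists_lift (g : N ⟶ N') :
    ∃ φ : P.complex ⟶ Q.complex, P.ι ≫ φ.f 0 = g ≫ Q.ι := by
  obtain ⟨z, hz⟩ := P.exists_factor_zero (Q.mem 0) (g ≫ Q.ι)
  obtain ⟨o, ho⟩ := P.exists_factor_one (Q.mem 1) (z ≫ Q.complex.d 0 1) (by
    rw [reassoc_of% hz, Q.ι_d, comp_zero])
  refine ⟨CochainComplex.mkHom _ _ z o ho.symm (fun n p => ?_), by simpa using hz⟩
  have h := P.exists_factor_succ (Q.mem (n + 2)) n (p.2.1 ≫ Q.complex.d (n + 1) (n + 2)) (by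
    rw [← reassoc_of% p.2.2, Q.complex.d_comp_d, comp_zero])
  exact ⟨h.choose, h.choose_spec.symm⟩

/-- A chain map of proper right resolutions which lifts zero is null-homotopic. -/
lemma nonempty_homotopy_zero (φ : P.complex ⟶ Q.complex) (h : P.ι ≫ φ.f 0 = 0) :
    Nonempty (Homotopy φ 0) := by
  obtain ⟨z, hz⟩ := P.exists_factor_one (Q.mem 0) (φ.f 0) h
  obtain ⟨o, ho⟩ := P.exists_factor_succ (Q.mem 1) 0 (φ.f 1 - z ≫ Q.complex.d 0 1) (by
    rw [Preadditive.comp_sub, reassoc_of% hz, φ.comm, sub_self])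
  refine ⟨Homotopy.mkCoinductive φ z hz.symm o (by rw [ho]; abel) (fun n p => ?_)⟩
  have h := P.exists_factor_succ (Q.mem (n + 2)) (n + 1)
    (φ.f (n + 2) - p.2.1 ≫ Q.complex.d (n + 1) (n + 2)) (by
      have := p.2.2
      have h2 := congrArg (· ≫ Q.complex.d (n + 1) (n + 2)) this
      simp only [Preadditive.add_comp, Category.assoc, Q.complex.d_comp_d, comp_zero, zero_add]
        at h2
      rw [Preadditive.comp_sub, ← φ.comm, sub_eq_zero]
      exact h2)
  exact ⟨h.choose, by rw [h.choose_spec]; abel⟩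

/-- Two lifts of the same morphism are homotopic. -/
lemma nonempty_homotopy (φ ψ : P.complex ⟶ Q.complex) (h : P.ι ≫ φ.f 0 = P.ι ≫ ψ.f 0) :
    Nonempty (Homotopy φ ψ) :=
  (P.nonempty_homotopy_zero Q (φ - ψ) (by simp [h])).map Homotopy.equivSubZero.symm

/-- A lift of a morphism to the proper right resolutions (unique up to homotopy). -/
def lift (g : N ⟶ N') : P.complex ⟶ Q.complex := (P.exists_lift Q g).choose

lemma ι_lift (g : N ⟶ N') : P.ι ≫ (P.lift Q g).f 0 = g ≫ Q.ι := (P.exists_lift Q g).choose_spec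

end ProperRightResolution

namespace ProperLeftResolution

variable {M M' M'' : C} (P : ProperLeftResolution F M) (Q : ProperLeftResolution F M')

lemma exists_factor_zero {X : C} (hX : F X) (f : X ⟶ M) :
    ∃ g : X ⟶ P.complex.X 0, g ≫ P.π = f :=
  exists_factor_of_homFrom (P.proper X hX) 0 f (by simp)

lemma exists_factor_one {X : C} (hX : F X) (f : X ⟶ P.complex.X 0) (hf : f ≫ P.π = 0) :
    ∃ g : X ⟶ P.complex.X 1, g ≫ P.complex.d 1 0 = f :=
  exists_factor_of_homFrom (P.proper X hX) 1 f (by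
    intro i hi
    obtain rfl : i = 0 := by lia
    exact hf)

lemma exists_factor_succ {X : C} (hX : F X) (n : ℕ) (f : X ⟶ P.complex.X (n + 1))
    (hf : f ≫ P.complex.d (n + 1) n = 0) :
    ∃ g : X ⟶ P.complex.X (n + 2), g ≫ P.complex.d (n + 2) (n + 1) = f :=
  exists_factor_of_homFrom (P.proper X hX) (n + 2) f (by
    intro i hi
    obtain rfl : i = n + 1 := by lia
    exact hf)

/-- Every morphism lifts to a chain map of proper left resolutions. -/
lemma exists_lift (g : M ⟶ M') :
    ∃ φ : P.complex ⟶ Q.complex, φ.f 0 ≫ Q.π = P.π ≫ g := by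
  obtain ⟨z, hz⟩ := Q.exists_factor_zero (P.mem 0) (P.π ≫ g)
  obtain ⟨o, ho⟩ := Q.exists_factor_one (P.mem 1) (P.complex.d 1 0 ≫ z) (by
    rw [Category.assoc, hz, reassoc_of% P.d_π, zero_comp])
  refine ⟨ChainComplex.mkHom _ _ z o ho (fun n p => ?_), by simpa using hz⟩
  have h := Q.exists_factor_succ (P.mem (n + 2)) n (P.complex.d (n + 2) (n + 1) ≫ p.2.1) (by
    rw [Category.assoc, p.2.2, P.complex.d_comp_d_assoc, zero_comp])
  exact ⟨h.choose, h.choose_spec⟩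

/-- A chain map of proper left resolutions which lifts zero is null-homotopic. -/
lemma nonempty_homotopy_zero (φ : P.complex ⟶ Q.complex) (h : φ.f 0 ≫ Q.π = 0) :
    Nonempty (Homotopy φ 0) := by
  obtain ⟨z, hz⟩ := Q.exists_factor_one (P.mem 0) (φ.f 0) h
  obtain ⟨o, ho⟩ := Q.exists_factor_succ (P.mem 1) 0 (φ.f 1 - P.complex.d 1 0 ≫ z) (by
    rw [Preadditive.sub_comp, Category.assoc, hz, φ.comm, sub_self])
  refine ⟨Homotopy.mkInductive φ z hz.symm o (by rw [ho]; abel) (fun n p => ?_)⟩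
  have h := Q.exists_factor_succ (P.mem (n + 2)) (n + 1)
    (φ.f (n + 2) - P.complex.d (n + 2) (n + 1) ≫ p.2.1) (by
      have := p.2.2
      have h2 := congrArg (P.complex.d (n + 2) (n + 1) ≫ ·) this
      simp only [Preadditive.comp_add, P.complex.d_comp_d_assoc, zero_comp, zero_add] at h2
      rw [Preadditive.sub_comp, φ.comm, sub_eq_zero, Category.assoc]
      exact h2)
  exact ⟨h.choose, by rw [h.choose_spec]; abel⟩

/-- Two lifts of the same morphism are homotopic. -/
lemma nonempty_homotopy (φ ψ : P.complex ⟶ Q.complex) (h : φ.f 0 ≫ Q.π = ψ.f 0 ≫ Q.π) :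
    Nonempty (Homotopy φ ψ) :=
  (P.nonempty_homotopy_zero Q (φ - ψ) (by simp [h])).map Homotopy.equivSubZero.symm

/-- A lift of a morphism to the proper left resolutions (unique up to homotopy). -/
def lift (g : M ⟶ M') : P.complex ⟶ Q.complex := (P.exists_lift Q g).choose

lemma lift_π (g : M ⟶ M') : (P.lift Q g).f 0 ≫ Q.π = P.π ≫ g := (P.exists_lift Q g).choose_spec

end ProperLeftResolution

end Resolutions

/-! ### Relative derived functors of `Hom` -/

section Derived

variable {C : Type w} [Category.{v} C] [Abelian C]

/-- The objects which have a proper right `F`-resolution, each taken with a choice of one.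
Morphisms are all morphisms between the underlying objects, so that two choices for the same
object are canonically isomorphic. -/
structure RightRes (F : ObjectProperty C) where
  /-- the object -/
  obj : C
  /-- the chosen resolution -/
  res : ProperRightResolution F obj

instance (F : ObjectProperty C) : Category (RightRes F) where
  Hom N N' := N.obj ⟶ N'.obj
  id N := 𝟙 N.obj
  comp f g := f ≫ g

/-- The objects which have a proper left `F`-resolution, each taken with a choice of one.
Morphisms are all morphisms between the underlying objects. -/
structure LeftRes (F : ObjectProperty C) where
  /-- the object -/
  obj : C
  /-- the chosen resolution -/
  res : ProperLeftResolution F obj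

instance (F : ObjectProperty C) : Category (LeftRes F) where
  Hom M M' := M.obj ⟶ M'.obj
  id M := 𝟙 M.obj
  comp f g := f ≫ g

/-- Forgetting the chosen resolution. -/
def RightRes.forget (F : ObjectProperty C) : RightRes F ⥤ C where
  obj N := N.obj
  map f := f

/-- Forgetting the chosen resolution. -/
def LeftRes.forget (F : ObjectProperty C) : LeftRes F ⥤ C where
  obj M := M.obj
  map f := f

/-- The right derived functors of `Hom` with respect to proper right `F`-resolutions of the second
variable: `(M, N) ↦ Hⁿ(Hom(M, G))`, where `G` is a proper right `F`-resolution of `N`. -/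
def extRight (F : ObjectProperty C) (n : ℕ) : Cᵒᵖ × RightRes F ⥤ AddCommGrpCat.{v} where
  obj p := (homFrom p.1.unop p.2.res.complex).homology n
  map {p q} f := HomologicalComplex.homologyMap
    (homFromMap f.1.unop (p.2.res.lift q.2.res f.2)) n
  map_id p := by
    have h := (p.2.res.nonempty_homotopy p.2.res (p.2.res.lift p.2.res (𝟙 p.2.obj)) (𝟙 _)
      (by simp [ProperRightResolution.ι_lift])).some
    refine (homologyMap_homFromMap_eq _ h n).trans ?_
    rw [← HomologicalComplex.homologyMap_id, ← homFromMap_id]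
    rfl
  map_comp {p q r} f g := by
    have h := (p.2.res.nonempty_homotopy r.2.res
      (p.2.res.lift r.2.res ((show p.2.obj ⟶ q.2.obj from f.2) ≫ g.2))
      (p.2.res.lift q.2.res f.2 ≫ q.2.res.lift r.2.res g.2)
      (by simp [ProperRightResolution.ι_lift, reassoc_of% (ProperRightResolution.ι_lift)])).some
    refine (homologyMap_homFromMap_eq _ h n).trans ?_
    rw [← HomologicalComplex.homologyMap_comp, ← homFromMap_comp]
    rfl

/-- The right derived functors of `Hom` with respect to proper left `F`-resolutions of the first
variable: `(M, N) ↦ Hⁿ(Hom(G, N))`, where `G` is a proper left `F`-resolution of `M`. -/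
def extLeft (F : ObjectProperty C) (n : ℕ) : (LeftRes F)ᵒᵖ × C ⥤ AddCommGrpCat.{v} where
  obj p := (homTo p.1.unop.res.complex p.2).homology n
  map {p q} f := HomologicalComplex.homologyMap
    (homToMap (q.1.unop.res.lift p.1.unop.res f.1.unop) f.2) n
  map_id p := by
    have h := (p.1.unop.res.nonempty_homotopy p.1.unop.res
      (p.1.unop.res.lift p.1.unop.res (𝟙 p.1.unop.obj)) (𝟙 _)
      (by simp [ProperLeftResolution.lift_π])).some
    refine (homologyMap_homToMap_eq h _ n).trans ?_
    rw [← HomologicalComplex.homologyMap_id, ← homToMap_id]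
    rfl
  map_comp {p q r} f g := by
    have h := (r.1.unop.res.nonempty_homotopy p.1.unop.res
      (r.1.unop.res.lift p.1.unop.res
        ((show r.1.unop.obj ⟶ q.1.unop.obj from g.1.unop) ≫ f.1.unop))
      (r.1.unop.res.lift q.1.unop.res g.1.unop ≫ q.1.unop.res.lift p.1.unop.res f.1.unop)
      (by simp [ProperLeftResolution.lift_π, reassoc_of% (ProperLeftResolution.lift_π)])).some
    refine (homologyMap_homToMap_eq h _ n).trans ?_
    rw [← HomologicalComplex.homologyMap_comp, ← homToMap_comp]
    rfl

end Derived

/-! ### Tensor products and Tor over an arbitrary ring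

Right `R`-modules are left modules over `Rᵐᵒᵖ`. -/

section Tor

variable (R : Type u) [Ring R]

open TensorProduct in
/-- The relations `n r ⊗ m = n ⊗ r m`. -/
def balancedRelations (N M : Type u) [AddCommGroup N] [Module Rᵐᵒᵖ N] [AddCommGroup M]
    [Module R M] : AddSubgroup (N ⊗[ℤ] M) :=
  AddSubgroup.closure {x | ∃ (n : N) (r : R) (m : M),
    x = (MulOpposite.op r • n) ⊗ₜ[ℤ] m - n ⊗ₜ[ℤ] (r • m)}

open TensorProduct in
/-- The abelian group `N ⊗_R M`, for a right module `N` and a left module `M`. -/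
abbrev BalancedTensor (N M : Type u) [AddCommGroup N] [Module Rᵐᵒᵖ N] [AddCommGroup M]
    [Module R M] : Type u :=
  (N ⊗[ℤ] M) ⧸ balancedRelations R N M

variable {R}

open TensorProduct in
/-- `f ⊗_R M : N ⊗_R M → N' ⊗_R M`. -/
def BalancedTensor.map {N N' : Type u} (M : Type u) [AddCommGroup N] [Module Rᵐᵒᵖ N]
    [AddCommGroup N'] [Module Rᵐᵒᵖ N'] [AddCommGroup M] [Module R M] (f : N →ₗ[Rᵐᵒᵖ] N') :
    BalancedTensor R N M →+ BalancedTensor R N' M :=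
  QuotientAddGroup.map _ _
    (LinearMap.rTensor M (f.toAddMonoidHom.toIntLinearMap)).toAddMonoidHom (by
      rw [balancedRelations, AddSubgroup.closure_le]
      rintro _ ⟨n, r, m, rfl⟩
      refine AddSubgroup.subset_closure ⟨f n, r, m, ?_⟩
      simp)

open TensorProduct in
lemma BalancedTensor.hom_ext {N M : Type u} [AddCommGroup N] [Module Rᵐᵒᵖ N] [AddCommGroup M]
    [Module R M] {A : Type u} [AddCommGroup A] {f g : BalancedTensor R N M →+ A}
    (h : ∀ n m, f (QuotientAddGroup.mk (n ⊗ₜ[ℤ] m)) = g (QuotientAddGroup.mk (n ⊗ₜ[ℤ] m))) :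
    f = g := by
  refine QuotientAddGroup.addMonoidHom_ext _ (AddMonoidHom.ext fun x => ?_)
  induction x using TensorProduct.induction_on with
  | zero => rw [map_zero, map_zero]
  | tmul n m => exact h n m
  | add x y hx hy => rw [map_add, map_add, hx, hy]

/-- The functor `- ⊗_R M` from right `R`-modules to abelian groups. -/
def tensorFunctor (M : ModuleCat.{u} R) : ModuleCat.{u} Rᵐᵒᵖ ⥤ AddCommGrpCat.{u} where
  obj N := AddCommGrpCat.of (BalancedTensor R N M)
  map f := AddCommGrpCat.ofHom (BalancedTensor.map M f.hom)
  map_id _ := AddCommGrpCat.hom_ext (BalancedTensor.hom_ext fun _ _ => rfl)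
  map_comp _ _ := AddCommGrpCat.hom_ext (BalancedTensor.hom_ext fun _ _ => rfl)

instance (M : ModuleCat.{u} R) : (tensorFunctor M).Additive where
  map_add {_ N' f g} := AddCommGrpCat.hom_ext (BalancedTensor.hom_ext fun n m =>
    congrArg (QuotientAddGroup.mk (s := balancedRelations R N' M))
      (TensorProduct.add_tmul (f.hom n) (g.hom n) m))

/-- `Tor_n^R(N, M)`, for a right module `N` and a left module `M`. -/
def tor (n : ℕ) (N : ModuleCat.{u} Rᵐᵒᵖ) (M : ModuleCat.{u} R) : AddCommGrpCat.{u} :=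
  ((tensorFunctor M).leftDerived n).obj N

end Tor

/-! ### Gorenstein weak injective and projective modules -/

section Modules

variable (R : Type u) [Ring R]

/-- Super finitely presented modules: those with a resolution by finitely generated projectives. -/
def superFinitelyPresented : ObjectProperty (ModuleCat.{u} R) := fun N =>
  ∃ P : ProjectiveResolution N, ∀ i, Module.Finite R (P.complex.X i)

/-- Weak injective modules. -/
def weakInjective : ObjectProperty (ModuleCat.{u} R) := fun M =>
  ∀ N, superFinitelyPresented R N → Subsingleton (Abelian.Ext N M 1)

/-- Weak flat (left) modules. -/
def weakFlat : ObjectProperty (ModuleCat.{u} R) := fun M =>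
  ∀ N, superFinitelyPresented Rᵐᵒᵖ N → IsZero (tor 1 N M)

/-- Gorenstein weak injective modules. In the exact sequence
`⋯ ⟶ I₁ ⟶ I₀ ⟶ I⁰ ⟶ I¹ ⟶ ⋯`, the terms `I₁, I₀, I⁰, I¹` sit in degrees `-2, -1, 0, 1`. -/
def gorensteinWeakInjective : ObjectProperty (ModuleCat.{u} R) := fun M =>
  ∃ I : CochainComplex (ModuleCat.{u} R) ℤ,
    (∀ i, Injective (I.X i)) ∧ I.Acyclic ∧
    (∀ W, weakInjective R W → (homFrom W I).Acyclic) ∧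
    Nonempty (M ≅ cokernel (I.d (-2) (-1)))

/-- Gorenstein weak projective modules. In the exact sequence
`⋯ ⟶ P₁ ⟶ P₀ ⟶ P⁰ ⟶ P¹ ⟶ ⋯`, the terms `P₁, P₀, P⁰, P¹` sit in degrees `-2, -1, 0, 1`. -/
def gorensteinWeakProjective : ObjectProperty (ModuleCat.{u} R) := fun M =>
  ∃ P : CochainComplex (ModuleCat.{u} R) ℤ,
    (∀ i, Projective (P.X i)) ∧ P.Acyclic ∧
    (∀ W, weakFlat R W → (homTo P W).Acyclic) ∧
    Nonempty (M ≅ cokernel (P.d (-2) (-1)))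

variable {R}

/-- There is an exact sequence `0 ⟶ M ⟶ G⁰ ⟶ ⋯ ⟶ Gⁿ ⟶ 0` with all `Gⁱ` Gorenstein weak
injective. -/
def HasGWICoresolution (M : ModuleCat.{u} R) (n : ℕ) : Prop :=
  ∃ (G : CochainComplex (ModuleCat.{u} R) ℕ) (f : M ⟶ G.X 0) (hf : f ≫ G.d 0 1 = 0),
    (G.augment f hf).Acyclic ∧ (∀ i ≤ n, gorensteinWeakInjective R (G.X i)) ∧
    ∀ i, n < i → IsZero (G.X i)

/-- There is an exact sequence `0 ⟶ G_n ⟶ ⋯ ⟶ G₀ ⟶ M ⟶ 0` with all `Gᵢ` Gorenstein weak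
projective. -/
def HasGWPResolution (M : ModuleCat.{u} R) (n : ℕ) : Prop :=
  ∃ (G : ChainComplex (ModuleCat.{u} R) ℕ) (f : G.X 0 ⟶ M) (hf : G.d 1 0 ≫ f = 0),
    (G.augment f hf).Acyclic ∧ (∀ i ≤ n, gorensteinWeakProjective R (G.X i)) ∧
    ∀ i, n < i → IsZero (G.X i)

/-- The Gorenstein weak injective dimension. -/
def gwid (M : ModuleCat.{u} R) : ℕ∞ := ⨅ (n : ℕ) (_ : HasGWICoresolution M n), (n : ℕ∞)

/-- The Gorenstein weak projective dimension. -/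
def gwpd (M : ModuleCat.{u} R) : ℕ∞ := ⨅ (n : ℕ) (_ : HasGWPResolution M n), (n : ℕ∞)

variable (R)

/-- Modules of finite Gorenstein weak injective dimension, with a chosen proper right resolution
by Gorenstein weak injective modules. -/
abbrev FiniteGWID : Type (u + 1) :=
  ObjectProperty.FullSubcategory
    (fun N : RightRes (gorensteinWeakInjective R) => gwid N.obj < ⊤)

/-- Modules of finite Gorenstein weak projective dimension, with a chosen proper left resolution
by Gorenstein weak projective modules. -/
abbrev FiniteGWPD : Type (u + 1) :=
  ObjectProperty.FullSubcategory
    (fun M : LeftRes (gorensteinWeakProjective R) => gwpd M.obj < ⊤)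

/-- `(M, N) ↦ Extⁿ_GWI(M, N)`, for `M` of finite Gorenstein weak projective dimension and `N` of
finite Gorenstein weak injective dimension. -/
def extGWI (n : ℕ) : (FiniteGWPD R)ᵒᵖ × FiniteGWID R ⥤ AddCommGrpCat.{u} :=
  (ObjectProperty.ι _ ⋙ LeftRes.forget _).op.prod (ObjectProperty.ι _) ⋙
    extRight (gorensteinWeakInjective R) n

/-- `(M, N) ↦ Extⁿ_GWP(M, N)`, for `M` of finite Gorenstein weak projective dimension and `N` of
finite Gorenstein weak injective dimension. -/
def extGWP (n : ℕ) : (FiniteGWPD R)ᵒᵖ × FiniteGWID R ⥤ AddCommGrpCat.{u} :=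
  (ObjectProperty.ι _).op.prod (ObjectProperty.ι _ ⋙ RightRes.forget _) ⋙
    extLeft (gorensteinWeakProjective R) n

end Modules

end GorensteinWeak

end

/-! Let `L` be a proper left resolution of `M` by Gorenstein weak projectives and `U` a proper right
resolution of `N` by Gorenstein weak injectives. The two Ext groups are the cohomologies of the
edges of the augmented double complex `Hom(L, U)`. They agree once all its other rows and columns
are exact, that is, once `L` stays exact under `Hom(-, Y)` for `Y` Gorenstein weak injective and `U`
under `Hom(X, -)` for `X` Gorenstein weak projective. Properness does not contain these conditions;
finite dimension supplies them.

Finite dimension of `M` yields `0 ⟶ K ⟶ G ⟶ M ⟶ 0` with `G` Gorenstein weak projective and `K` of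
finite projective dimension (`exists_gorensteinProjective_approximation`). Shifting along the
resolution of `K` gives `Ext¹(X, K) = 0` for every Gorenstein weak projective `X`, so the sequence
is proper. A Gorenstein weak injective `Y` is a quotient of an injective by a module of the same
kind, hence `Ext¹(K, Y) = 0` too, every morphism `K ⟶ Y` factors through an injective over `Y`, and
so it extends to `G` (`exists_balancedStep`). Iterating gives one resolution with both properties.
Proper resolutions of the same module are homotopy equivalent, so the second property passes to all
of them (`ProperLeftResolution.homTo_acyclic`).

The isomorphism is the zigzag correspondence in the double complex
(`exists_homology_iso_of_zigzag`); it is natural because chain maps carry zigzags to zigzags.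

Weak flat and weak injective modules enter only as test classes containing the projectives and the
injectives respectively. The theory is therefore developed for a test class in an abelian category,
and the injective half is the projective half in the opposite category. -/

namespace GorensteinWeak

/-! ### Short exact sequences in an abelian category -/

section ShortExact

open ZeroObject

variable {C : Type w} [Category.{v} C] [Abelian C]

/-- The sequence `0 ⟶ A ⟶ B ⟶ D ⟶ 0` is exact. -/
def IsShortExact {A B D : C} (f : A ⟶ B) (g : B ⟶ D) : Prop :=
  ∃ h : f ≫ g = 0, (ShortComplex.mk f g h).ShortExact

namespace IsShortExact

variable {A B D : C} {f : A ⟶ B} {g : B ⟶ D}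

lemma zero (h : IsShortExact f g) : f ≫ g = 0 := h.1
lemma mono (h : IsShortExact f g) : Mono f := h.2.mono_f
lemma epi (h : IsShortExact f g) : Epi g := h.2.epi_g

lemma exists_lift (h : IsShortExact f g) {X : C} (x : X ⟶ B) (hx : x ≫ g = 0) :
    ∃ y : X ⟶ A, y ≫ f = x :=
  have := h.mono
  ⟨h.2.exact.lift x hx, h.2.exact.lift_f x hx⟩

lemma exists_desc (h : IsShortExact f g) {X : C} (x : B ⟶ X) (hx : f ≫ x = 0) :
    ∃ y : D ⟶ X, g ≫ y = x :=
  have := h.epi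
  ⟨h.2.exact.desc x hx, h.2.exact.g_desc x hx⟩

/-- Uniqueness of the factorization is automatic for an epimorphism `g`, so existence is all that
has to be checked. -/
lemma of_exists_desc (h : f ≫ g = 0) [Mono f] [Epi g]
    (hd : ∀ (X : C) (x : B ⟶ X), f ≫ x = 0 → ∃ y : D ⟶ X, g ≫ y = x) : IsShortExact f g :=
  ⟨h, { exact := (ShortComplex.mk f g h).exact_of_g_is_cokernel
          (CokernelCofork.IsColimit.ofπ g h (fun x hx => (hd _ x hx).choose)
            (fun x hx => (hd _ x hx).choose_spec)
            (fun x hx m hm => by rw [← cancel_epi g, hm, (hd _ x hx).choose_spec])) }⟩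

protected lemma op (h : IsShortExact f g) : IsShortExact g.op f.op :=
  ⟨by rw [← op_comp, h.zero, op_zero], h.2.op⟩

lemma unop {A B D : Cᵒᵖ} {f : A ⟶ B} {g : B ⟶ D} (h : IsShortExact f g) :
    IsShortExact g.unop f.unop :=
  ⟨by rw [← unop_comp, h.zero, unop_zero], h.2.unop⟩

lemma of_mono (f : A ⟶ B) [Mono f] : IsShortExact f (cokernel.π f) :=
  of_exists_desc (cokernel.condition f) fun _ x hx => ⟨cokernel.desc f x hx, by simp⟩

lemma comp_iso (h : IsShortExact f g) {D' : C} (e : D ≅ D') : IsShortExact f (g ≫ e.hom) :=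
  have := h.mono
  have := h.epi
  of_exists_desc (by rw [reassoc_of% h.zero, zero_comp]) fun _ x hx => by
    obtain ⟨y, hy⟩ := h.exists_desc x hx
    exact ⟨e.inv ≫ y, by simpa using hy⟩

lemma iso_comp (h : IsShortExact f g) {A' : C} (e : A' ≅ A) : IsShortExact (e.hom ≫ f) g :=
  have := h.mono
  have := h.epi
  of_exists_desc (by rw [Category.assoc, h.zero, comp_zero]) fun _ x hx =>
    h.exists_desc x (by rw [← cancel_epi e.hom]; simpa using hx)

lemma zero_id (A : C) : IsShortExact (0 : (0 : C) ⟶ A) (𝟙 A) :=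
  of_exists_desc (by simp) fun _ x _ => ⟨x, by simp⟩

lemma id_zero (A : C) : IsShortExact (𝟙 A) (0 : A ⟶ (0 : C)) :=
  of_exists_desc (by simp) fun _ x hx => ⟨0, by simpa using hx.symm⟩

lemma biprod (A B : C) : IsShortExact (biprod.inl : A ⟶ A ⊞ B) biprod.snd :=
  of_exists_desc (by simp) fun _ x hx => ⟨biprod.inr ≫ x, by
    ext <;> simp [hx]⟩

/-- Pushing out `0 ⟶ A ⟶ B ⟶ D ⟶ 0` along `a : A ⟶ A'`. -/
lemma exists_pushout (h : IsShortExact f g) {A' : C} (a : A ⟶ A') :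
    ∃ (B' : C) (f' : A' ⟶ B') (g' : B' ⟶ D) (b : B ⟶ B'), IsShortExact f' g' ∧
      (∀ (K : C) (k : K ⟶ A), IsShortExact k a → IsShortExact (k ≫ f) b) ∧
      (∀ (E : C) (e : A' ⟶ E), IsShortExact a e → ∃ e' : B' ⟶ E, IsShortExact b e') := by
  have := h.mono
  have := h.epi
  have hg : f ≫ g = a ≫ (0 : A' ⟶ D) := by rw [h.zero, comp_zero]
  refine ⟨pushout f a, pushout.inr _ _, pushout.desc g 0 hg, pushout.inl _ _, ?_, ?_, ?_⟩
  · have : Epi (pushout.desc g 0 hg) := epi_of_epi_fac (pushout.inl_desc _ _ hg)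
    refine of_exists_desc (pushout.inr_desc _ _ hg) fun X x hx => ?_
    obtain ⟨y, hy⟩ := h.exists_desc (pushout.inl f a ≫ x) (by
      rw [pushout.condition_assoc, hx, comp_zero])
    refine ⟨y, pushout.hom_ext ?_ ?_⟩
    · rw [pushout.inl_desc_assoc, hy]
    · rw [pushout.inr_desc_assoc, zero_comp, hx]
  · intro K k hk
    have := hk.mono
    have := hk.epi
    have : Epi (pushout.inl f a) := inferInstance
    refine of_exists_desc
      (by rw [Category.assoc, pushout.condition, reassoc_of% hk.zero, zero_comp]) fun X x hx => ?_
    obtain ⟨y, hy⟩ := hk.exists_desc (f ≫ x) (by simpa using hx)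
    exact ⟨pushout.desc x y hy.symm, pushout.inl_desc _ _ _⟩
  · intro E e he
    have := he.mono
    have := he.epi
    have he' : f ≫ (0 : B ⟶ E) = a ≫ e := by rw [he.zero, comp_zero]
    have : Epi (pushout.desc 0 e he') := epi_of_epi_fac (pushout.inr_desc _ _ he')
    have : Mono (pushout.inl f a) := inferInstance
    refine ⟨_, of_exists_desc (pushout.inl_desc _ _ he') fun X x hx => ?_⟩
    obtain ⟨y, hy⟩ := he.exists_desc (pushout.inr f a ≫ x) (by
      rw [← pushout.condition_assoc, hx, comp_zero])
    refine ⟨y, pushout.hom_ext ?_ ?_⟩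
    · rw [pushout.inl_desc_assoc, zero_comp, hx]
    · rw [pushout.inr_desc_assoc, hy]

/-- The cokernels of a monomorphism of short exact sequences form a short exact sequence. -/
lemma exists_cokernel (h : IsShortExact f g) {A' B' D' : C} {f' : A' ⟶ B'} {g' : B' ⟶ D'}
    (h' : IsShortExact f' g') {a : A ⟶ A'} {b : B ⟶ B'} {d : D ⟶ D'} (hab : a ≫ f' = f ≫ b)
    (hbd : b ≫ g' = g ≫ d) {A'' D'' : C} {α : A' ⟶ A''} {δ : D' ⟶ D''}
    (ha : IsShortExact a α) (hd : IsShortExact d δ) :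
    ∃ (B'' : C) (β : B' ⟶ B'') (f'' : A'' ⟶ B'') (g'' : B'' ⟶ D''),
      IsShortExact b β ∧ IsShortExact f'' g'' := by
  have := h.mono; have := h.epi; have := h'.mono; have := h'.epi
  have := ha.mono; have := ha.epi; have := hd.mono; have := hd.epi
  -- Four lemma: a morphism killed by `b` dies in `D`, hence comes from `A`, where `a ≫ f'` is mono.
  have hb : Mono b := by
    refine Preadditive.mono_of_cancel_zero _ fun x hx => ?_
    obtain ⟨y, rfl⟩ := h.exists_lift x (by
      rw [← cancel_mono d, Category.assoc, ← hbd, reassoc_of% hx]; simp)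
    have : y ≫ a = 0 := by
      rw [← cancel_mono f', Category.assoc, hab, zero_comp, ← Category.assoc, hx]
    rw [(cancel_mono a).1 (this.trans zero_comp.symm), zero_comp]
  obtain ⟨f'', hf''⟩ := ha.exists_desc (f' ≫ cokernel.π b) (by
    rw [reassoc_of% hab, cokernel.condition, comp_zero])
  obtain ⟨g'', hg''⟩ := (of_mono b).exists_desc (g' ≫ δ) (by
    rw [reassoc_of% hbd, hd.zero, comp_zero])
  have hz : f'' ≫ g'' = 0 := by
    rw [← cancel_epi α, reassoc_of% hf'', hg'', reassoc_of% h'.zero]; simp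
  refine ⟨_, _, f'', g'', of_mono b, ?_⟩
  have : Epi g'' := epi_of_epi_fac hg''
  have : Mono f'' := by
    refine Preadditive.mono_of_cancel_zero _ fun {X} x hx => ?_
    -- A generalized element of `A''` lifts to `A'` after an epimorphic refinement; the chase shows
    -- that the lift comes from `A`.
    obtain ⟨X₁, π₁, _, x₁, hx₁⟩ := surjective_up_to_refinements_of_epi α x
    obtain ⟨y, hy⟩ := (of_mono b).exists_lift (x₁ ≫ f') (by
      rw [Category.assoc, ← hf'', ← reassoc_of% hx₁, hx, comp_zero])
    obtain ⟨z, rfl⟩ := h.exists_lift y (by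
      rw [← cancel_mono d, Category.assoc, ← hbd, reassoc_of% hy, h'.zero]; simp)
    have : z ≫ a = x₁ := by
      rw [← cancel_mono f', Category.assoc, hab, ← hy, Category.assoc]
    rw [← cancel_epi π₁, hx₁, ← this, Category.assoc, ha.zero]; simp
  refine of_exists_desc hz fun X x hx => ?_
  obtain ⟨y, hy⟩ := h'.exists_desc (cokernel.π b ≫ x) (by rw [← reassoc_of% hf'', hx, comp_zero])
  obtain ⟨t, ht⟩ := hd.exists_desc y (by
    rw [← cancel_epi g, ← reassoc_of% hbd, hy]; simp)
  exact ⟨t, by rw [← cancel_epi (cokernel.π b), reassoc_of% hg'', ht, hy]⟩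

/-- The kernels of an epimorphism of short exact sequences form a short exact sequence. -/
lemma exists_kernel (h : IsShortExact f g) {A' B' D' : C} {f' : A' ⟶ B'} {g' : B' ⟶ D'}
    (h' : IsShortExact f' g') {a : A' ⟶ A} {b : B' ⟶ B} {d : D' ⟶ D} (hab : a ≫ f = f' ≫ b)
    (hbd : b ≫ g = g' ≫ d) {A'' D'' : C} {α : A'' ⟶ A'} {δ : D'' ⟶ D'}
    (ha : IsShortExact α a) (hd : IsShortExact δ d) :
    ∃ (B'' : C) (β : B'' ⟶ B') (f'' : A'' ⟶ B'') (g'' : B'' ⟶ D''),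
      IsShortExact β b ∧ IsShortExact f'' g'' := by
  obtain ⟨B'', β, g'', f'', hβ, hfg⟩ := h.op.exists_cokernel h'.op (a := d.op) (b := b.op)
    (d := a.op) (congrArg Quiver.Hom.op hbd.symm) (congrArg Quiver.Hom.op hab.symm) hd.op ha.op
  exact ⟨_, _, _, _, hβ.unop, hfg.unop⟩

end IsShortExact

end ShortExact

/-! ### Vanishing of `Ext¹` and extension problems -/

section Ext

variable {C : Type w} [Category.{v} C] [Abelian C] [HasExt.{u} C]
variable {A B D : C} {f : A ⟶ B} {g : B ⟶ D}

open Abelian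

lemma IsShortExact.exists_extension (h : IsShortExact f g) {K : C} (hK : Subsingleton (Ext D K 1))
    (x : A ⟶ K) : ∃ y : B ⟶ K, f ≫ y = x := by
  obtain ⟨y, hy⟩ := Ext.contravariant_sequence_exact₁ h.2 K (Ext.mk₀ x) (add_zero 1)
    (Subsingleton.elim _ _)
  obtain ⟨y, rfl⟩ := Ext.addEquiv₀.symm.surjective y
  refine ⟨y, Ext.addEquiv₀.symm.injective ?_⟩
  simpa [Ext.mk₀_comp_mk₀] using hy

lemma IsShortExact.exists_lifting (h : IsShortExact f g) {X : C} (hX : Subsingleton (Ext X A 1))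
    (x : X ⟶ D) : ∃ y : X ⟶ B, y ≫ g = x := by
  obtain ⟨y, hy⟩ := Ext.covariant_sequence_exact₃ X h.2 (Ext.mk₀ x) (zero_add 1)
    (Subsingleton.elim _ _)
  obtain ⟨y, rfl⟩ := Ext.addEquiv₀.symm.surjective y
  refine ⟨y, Ext.addEquiv₀.symm.injective ?_⟩
  simpa [Ext.mk₀_comp_mk₀] using hy

/-- Since `Ext¹(B, K)` vanishes, every class in `Ext¹(D, K)` is the connecting image of some `A ⟶
K`, and that image is zero when the morphism extends to `B`. -/
lemma IsShortExact.subsingleton_ext_of_extension (h : IsShortExact f g) {K : C}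
    (hB : Subsingleton (Ext B K 1)) (hx : ∀ x : A ⟶ K, ∃ y : B ⟶ K, f ≫ y = x) :
    Subsingleton (Ext D K 1) := by
  refine subsingleton_of_forall_eq 0 fun e => ?_
  obtain ⟨x, rfl⟩ := Ext.contravariant_sequence_exact₃ h.2 K e (Subsingleton.elim _ _) (add_zero 1)
  obtain ⟨x, rfl⟩ := Ext.addEquiv₀.symm.surjective x
  obtain ⟨y, rfl⟩ := hx x
  change h.2.extClass.comp (Ext.mk₀ (f ≫ y)) (add_zero 1) = 0
  rw [← Ext.mk₀_comp_mk₀, ← Ext.comp_assoc_of_second_deg_zero, h.2.extClass_comp, Ext.zero_comp]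

lemma IsShortExact.subsingleton_ext_middle (h : IsShortExact f g) {K : C}
    (hA : Subsingleton (Ext A K 1)) (hD : Subsingleton (Ext D K 1)) :
    Subsingleton (Ext B K 1) := by
  refine subsingleton_of_forall_eq 0 fun e => ?_
  obtain ⟨x, rfl⟩ := Ext.contravariant_sequence_exact₂ h.2 K e (Subsingleton.elim _ _)
  rw [Subsingleton.elim x 0, Ext.comp_zero]

end Ext

/-! ### Gorenstein projective objects relative to a test class -/

section GorensteinProjective

open Abelian ZeroObject

variable {C : Type w} [Category.{v} C] [Abelian C]

/-- There is an exact sequence `0 ⟶ X ⟶ P ⟶ Y ⟶ 0` with `P` projective which stays exact under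
`Hom(-, T)` for all `T` in `W`. -/
def ProjectiveStep (W : ObjectProperty C) (X Y : C) : Prop :=
  ∃ (P : C) (f : X ⟶ P) (g : P ⟶ Y), IsShortExact f g ∧ Projective P ∧
    ∀ T, W T → ∀ x : X ⟶ T, ∃ y : P ⟶ T, f ≫ y = x

/-- A class of objects closed under syzygies and cosyzygies along projective steps. -/
structure IsGorensteinClass (W G : ObjectProperty C) : Prop where
  syzygy : ∀ X, G X → ∃ Y, G Y ∧ ProjectiveStep W Y X
  cosyzygy : ∀ X, G X → ∃ Y, G Y ∧ ProjectiveStep W X Y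

/-- The Gorenstein projective objects with respect to the test class `W`. -/
def gorensteinProjective (W : ObjectProperty C) : ObjectProperty C :=
  fun X => ∃ G, IsGorensteinClass W G ∧ G X

/-- The objects with a finite resolution by objects in `G`. -/
inductive HasFiniteResolution (G : ObjectProperty C) : C → Prop
  | of {X : C} (h : G X) : HasFiniteResolution G X
  | step {Y X Z : C} (f : Y ⟶ X) (g : X ⟶ Z) (h : IsShortExact f g) (hX : G X)
      (hY : HasFiniteResolution G Y) : HasFiniteResolution G Z

lemma HasFiniteResolution.mono {G G' : ObjectProperty C} (h : G ≤ G') {X : C}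
    (hX : HasFiniteResolution G X) : HasFiniteResolution G' X := by
  induction hX with
  | of hX => exact .of (h _ hX)
  | step f g hfg hX _ ih => exact .step f g hfg (h _ hX) ih

variable {W : ObjectProperty C}

/-- A union of Gorenstein classes is one, so this is the largest. Membership can thus be proved
coinductively, by exhibiting any closed class. -/
lemma isGorensteinClass_gorensteinProjective (W : ObjectProperty C) :
    IsGorensteinClass W (gorensteinProjective W) where
  syzygy := by
    rintro X ⟨G, hG, hX⟩
    obtain ⟨Y, hY, h⟩ := hG.syzygy X hX
    exact ⟨Y, ⟨G, hG, hY⟩, h⟩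
  cosyzygy := by
    rintro X ⟨G, hG, hX⟩
    obtain ⟨Y, hY, h⟩ := hG.cosyzygy X hX
    exact ⟨Y, ⟨G, hG, hY⟩, h⟩

lemma projective_le_gorensteinProjective (W : ObjectProperty C) :
    (fun X => Projective X : ObjectProperty C) ≤ gorensteinProjective W := by
  refine fun X hX => ⟨fun X => Projective X, ⟨fun X hX => ?_, fun X hX => ?_⟩, hX⟩
  · exact ⟨0, inferInstance, X, _, _, .zero_id X, hX,
      fun _ _ x => ⟨0, (isZero_zero C).eq_of_src _ _⟩⟩
  · exact ⟨0, inferInstance, X, _, _, .id_zero X, hX, fun _ _ x => ⟨x, by simp⟩⟩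

section

variable [HasExt.{u} C]

lemma subsingleton_ext_projective (P K : C) [Projective P] : Subsingleton (Ext P K 1) :=
  HasProjectiveDimensionLT.subsingleton P 1 1 le_rfl K

lemma subsingleton_ext_injective (X I : C) [Injective I] : Subsingleton (Ext X I 1) :=
  HasInjectiveDimensionLT.subsingleton I 1 1 le_rfl X

lemma subsingleton_ext_of_gorensteinProjective {X T : C} (hX : gorensteinProjective W X)
    (hT : W T) : Subsingleton (Ext X T 1) := by
  obtain ⟨Y, -, P, f, g, h, hP, hT'⟩ := (isGorensteinClass_gorensteinProjective W).syzygy X hX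
  exact h.subsingleton_ext_of_extension (subsingleton_ext_projective P T) (hT' T hT)

/-- Dimension shifting that never leaves degree one. A morphism from the syzygy `Y` to `K` lifts to
`Q`, because `Y` is again Gorenstein projective and has no `Ext¹` into `K'`; the lift extends to
`P`, because `Q` is a test object. -/
lemma subsingleton_ext_of_hasFiniteResolution
    (hW : (fun X => Projective X : ObjectProperty C) ≤ W) {K : C}
    (hK : HasFiniteResolution (fun X => Projective X) K) :
    ∀ X, gorensteinProjective W X → Subsingleton (Ext X K 1) := by
  induction hK with
  | of h => exact fun X hX => subsingleton_ext_of_gorensteinProjective hX (hW _ h)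
  | @step K' Q K f g h hQ hK' ih =>
    intro X hX
    obtain ⟨Y, hY, P, i, p, hip, hP, -⟩ :=
      (isGorensteinClass_gorensteinProjective W).syzygy X hX
    refine hip.subsingleton_ext_of_extension (subsingleton_ext_projective P K) fun x => ?_
    obtain ⟨y, rfl⟩ := h.exists_lifting (ih Y hY) x
    obtain ⟨z, rfl⟩ := hip.exists_extension
      (subsingleton_ext_of_gorensteinProjective hX (hW _ hQ)) y
    exact ⟨z ≫ g, by simp⟩

/-- A morphism `K' ⟶ X` lifts to the injective `I` by induction, applied to the kernel `Y`, and then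
extends to `Q` by injectivity of `I`. -/
lemma subsingleton_ext_of_injective_syzygies {E : ObjectProperty C}
    (hE : ∀ X, E X → ∃ (Y I : C) (f : Y ⟶ I) (g : I ⟶ X), IsShortExact f g ∧ E Y ∧ Injective I)
    {K : C} (hK : HasFiniteResolution (fun X => Projective X) K) :
    ∀ X, E X → Subsingleton (Ext K X 1) := by
  induction hK with
  | @of K h => exact fun X _ => have : Projective K := h; subsingleton_ext_projective K X
  | @step K' Q K f g h hQ hK' ih =>
    intro X hX
    obtain ⟨Y, I, i, p, hip, hY, hI⟩ := hE X hX
    refine h.subsingleton_ext_of_extension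
      (have : Projective Q := hQ; subsingleton_ext_projective Q X) fun x => ?_
    obtain ⟨y, rfl⟩ := hip.exists_lifting (ih Y hY) x
    have := h.mono
    exact ⟨Injective.factorThru y f ≫ p, by simp⟩

end

/-- Gorenstein projective objects are closed under extensions. -/
lemma gorensteinProjective_of_isShortExact
    (hW : (fun X => Projective X : ObjectProperty C) ≤ W) {A B D : C} {f : A ⟶ B} {g : B ⟶ D}
    (h : IsShortExact f g) (hA : gorensteinProjective W A) (hD : gorensteinProjective W D) :
    gorensteinProjective W B := by
  let := HasExt.standard C
  -- Coinduction on the class of all extensions of Gorenstein projectives.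
  refine ⟨fun B => ∃ (A D : C) (f : A ⟶ B) (g : B ⟶ D), IsShortExact f g ∧
    gorensteinProjective W A ∧ gorensteinProjective W D, ⟨?_, ?_⟩, A, D, f, g, h, hA, hD⟩
  · rintro B ⟨A, D, f, g, h, hA, hD⟩
    obtain ⟨A', hA', P, i, p, hip, hP, -⟩ :=
      (isGorensteinClass_gorensteinProjective W).syzygy A hA
    obtain ⟨D', hD', Q, j, q, hjq, hQ, -⟩ :=
      (isGorensteinClass_gorensteinProjective W).syzygy D hD
    have := h.epi
    -- Horseshoe: `q` lifts through `g` because `Q` is projective.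
    obtain ⟨B', β, f', g', hβ, hfg⟩ := h.exists_kernel (.biprod P Q)
      (b := biprod.desc (p ≫ f) (Projective.factorThru q g)) (by simp)
      (by ext <;> simp [h.zero]) hip hjq
    exact ⟨B', ⟨A', D', f', g', hfg, hA', hD'⟩, _, _, _, hβ, inferInstance,
      fun T hT => hβ.exists_extension (h.subsingleton_ext_middle
        (subsingleton_ext_of_gorensteinProjective hA hT)
        (subsingleton_ext_of_gorensteinProjective hD hT))⟩
  · rintro B ⟨A, D, f, g, h, hA, hD⟩
    obtain ⟨A', hA', P, i, p, hip, hP, -⟩ :=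
      (isGorensteinClass_gorensteinProjective W).cosyzygy A hA
    obtain ⟨D', hD', Q, j, q, hjq, hQ, -⟩ :=
      (isGorensteinClass_gorensteinProjective W).cosyzygy D hD
    -- The dual horseshoe needs `i` to extend to `B`. It does since `P`, being projective, is a test
    -- object, so `Ext¹(D, P) = 0`.
    obtain ⟨y, hy⟩ := h.exists_extension
      (subsingleton_ext_of_gorensteinProjective hD (hW _ hP)) i
    obtain ⟨B', β, f', g', hβ, hfg⟩ := h.exists_cokernel (.biprod P Q)
      (b := biprod.lift y (g ≫ j)) (by ext <;> simp [hy, reassoc_of% h.zero])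
      (by simp) hip hjq
    exact ⟨B', ⟨A', D', f', g', hfg, hA', hD'⟩, _, _, _, hβ, inferInstance,
      fun T hT => hβ.exists_extension (hfg.subsingleton_ext_middle
        (subsingleton_ext_of_gorensteinProjective hA' hT)
        (subsingleton_ext_of_gorensteinProjective hD' hT))⟩

/-- Objects of finite Gorenstein projective dimension have a Gorenstein projective approximation
whose kernel has finite projective dimension. -/
lemma exists_gorensteinProjective_approximation
    (hW : (fun X => Projective X : ObjectProperty C) ≤ W) {M : C}
    (hM : HasFiniteResolution (gorensteinProjective W) M) :
    ∃ (K G : C) (f : K ⟶ G) (g : G ⟶ M), IsShortExact f g ∧ gorensteinProjective W G ∧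
      HasFiniteResolution (fun X => Projective X) K := by
  induction hM with
  | @of M h => exact ⟨0, M, _, _, .zero_id M, h, .of inferInstance⟩
  | @step M' G₀ M f g h hG₀ hM' ih =>
    obtain ⟨K', G', k, p, hkp, hG', hK'⟩ := ih
    -- Pushing `0 ⟶ G' ⟶ Q ⟶ G'' ⟶ 0` out along `p` gives `L`, an extension of `G''` by `M'` which
    -- is also the quotient of `Q` by `K'`, so of finite projective dimension. Pushing out along `M'
    -- ⟶ L` then makes `L` the kernel, and the new middle term `G` is an extension of `G''` by `G₀`.
    obtain ⟨G'', hG'', Q, i, q, hiq, hQ, -⟩ :=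
      (isGorensteinClass_gorensteinProjective W).cosyzygy G' hG'
    obtain ⟨L, i', q', b, hL, hK, -⟩ := hiq.exists_pushout p
    obtain ⟨G, j, r, c, hG, -, hc⟩ := h.exists_pushout i'
    obtain ⟨s, hs⟩ := hc _ _ hL
    exact ⟨L, G, j, r, hG, gorensteinProjective_of_isShortExact hW hs hG₀ hG'',
      .step _ _ (hK _ _ hkp) hQ hK'⟩

/-- There is an exact sequence `0 ⟶ K ⟶ X ⟶ M ⟶ 0` with `X` in `G` which stays exact under
`Hom(Y, -)` for all `Y` in `G` and under `Hom(-, Y)` for all `Y` in `E`. -/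
def BalancedStep (G E : ObjectProperty C) (K M : C) : Prop :=
  ∃ (X : C) (f : K ⟶ X) (g : X ⟶ M), IsShortExact f g ∧ G X ∧
    (∀ Y, G Y → ∀ y : Y ⟶ M, ∃ z : Y ⟶ X, z ≫ g = y) ∧
    ∀ Y, E Y → ∀ y : K ⟶ Y, ∃ z : X ⟶ Y, f ≫ z = y

/-- Extending `K ⟶ Y` along `f` does not rest on any vanishing for `M`: finite projective dimension
of `K` lets the morphism factor through an injective over `Y`, and the factor into the injective
extends. -/
lemma exists_balancedStep (hW : (fun X => Projective X : ObjectProperty C) ≤ W)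
    {E : ObjectProperty C}
    (hE : ∀ X, E X → ∃ (Y I : C) (f : Y ⟶ I) (g : I ⟶ X), IsShortExact f g ∧ E Y ∧ Injective I)
    {M : C} (hM : HasFiniteResolution (gorensteinProjective W) M) :
    ∃ K, HasFiniteResolution (gorensteinProjective W) K ∧
      BalancedStep (gorensteinProjective W) E K M := by
  let := HasExt.standard C
  obtain ⟨K, G, f, g, h, hG, hK⟩ := exists_gorensteinProjective_approximation hW hM
  refine ⟨K, hK.mono (projective_le_gorensteinProjective W), G, f, g, h, hG,
    fun Y hY => h.exists_lifting (subsingleton_ext_of_hasFiniteResolution hW hK Y hY),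
    fun Y hY y => ?_⟩
  obtain ⟨Y', I, i, p, hip, hY', hI⟩ := hE Y hY
  obtain ⟨z, rfl⟩ := hip.exists_lifting (subsingleton_ext_of_injective_syzygies hE hK Y' hY') y
  have := h.mono
  exact ⟨Injective.factorThru z f ≫ p, by simp⟩

lemma exists_seq_balancedStep (hW : (fun X => Projective X : ObjectProperty C) ≤ W)
    {E : ObjectProperty C}
    (hE : ∀ X, E X → ∃ (Y I : C) (f : Y ⟶ I) (g : I ⟶ X), IsShortExact f g ∧ E Y ∧ Injective I)
    {M : C} (hM : HasFiniteResolution (gorensteinProjective W) M) :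
    ∃ Z : ℕ → C, Z 0 = M ∧ ∀ n, BalancedStep (gorensteinProjective W) E (Z (n + 1)) (Z n) := by
  choose K hK hstep using fun X : {X : C // HasFiniteResolution (gorensteinProjective W) X} =>
    exists_balancedStep hW hE X.2
  let Z : ℕ → {X : C // HasFiniteResolution (gorensteinProjective W) X} :=
    fun n => n.rec ⟨M, hM⟩ fun _ X => ⟨K X, hK X⟩
  exact ⟨fun n => (Z n).1, rfl, fun n => hstep (Z n)⟩

end GorensteinProjective

/-! ### Two-sided sequences -/

section TwoSided

/-- A relation which is total and surjective on a class can be iterated in both directions. -/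
lemma exists_int_seq {α : Type*} (r : α → α → Prop) (G : α → Prop)
    (hl : ∀ x, G x → ∃ y, G y ∧ r y x) (hr : ∀ x, G x → ∃ y, G y ∧ r x y) (x : α) (hx : G x) :
    ∃ Z : ℤ → α, Z 0 = x ∧ ∀ i, r (Z i) (Z (i + 1)) := by
  choose L hL hLr using fun x : {x // G x} => hl x x.2
  choose R hR hRr using fun x : {x // G x} => hr x x.2
  let P : ℕ → {x // G x} := fun n => n.rec ⟨x, hx⟩ fun _ y => ⟨R y, hR y⟩
  let N : ℕ → {x // G x} := fun n => n.rec ⟨x, hx⟩ fun _ y => ⟨L y, hL y⟩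
  -- Both halves start at `x`, so the negative half is shifted by one to count `x` only once.
  let Z : ℤ → {x // G x} := fun i => match i with
    | .ofNat n => P n
    | .negSucc n => N (n + 1)
  refine ⟨fun i => (Z i).1, rfl, fun i => ?_⟩
  match i with
  | .ofNat n => exact hRr (P n)
  | .negSucc 0 => exact hLr (N 0)
  | .negSucc (n + 1) => exact hLr (N (n + 1))

end TwoSided

/-! ### Exactness of Hom complexes -/

section HomExact

variable {C : Type w} [Category.{v} C] [Abelian C] {ι : Type} {c : ComplexShape ι}

lemma homTo_exactAt_iff (K : HomologicalComplex C c) (X : C) {i j k : ι} (hi : c.prev j = i)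
    (hk : c.next j = k) : (homTo K X).ExactAt j ↔
      ∀ x : K.X j ⟶ X, K.d i j ≫ x = 0 → ∃ y : K.X k ⟶ X, K.d j k ≫ y = x := by
  rw [(homTo K X).exactAt_iff' k j i hk hi,
    ShortComplex.ab_exact_iff]
  rfl

lemma homFrom_exactAt_iff (K : HomologicalComplex C c) (X : C) {i j k : ι} (hi : c.prev j = i)
    (hk : c.next j = k) : (homFrom X K).ExactAt j ↔
      ∀ x : X ⟶ K.X j, x ≫ K.d j k = 0 → ∃ y : X ⟶ K.X i, y ≫ K.d i j = x := by
  rw [(homFrom X K).exactAt_iff' i j k hi hk, ShortComplex.ab_exact_iff]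
  rfl

end HomExact

/-! ### Splicing, and Gorenstein objects as cokernels in complexes -/

section Splice

variable {C : Type w} [Category.{v} C] [Abelian C]

lemma IsShortExact.of_exists_lift {A B D : C} {f : A ⟶ B} {g : B ⟶ D} (h : f ≫ g = 0) [Mono f]
    [Epi g] (hd : ∀ (X : C) (x : X ⟶ B), x ≫ g = 0 → ∃ y : X ⟶ A, y ≫ f = x) :
    IsShortExact f g :=
  ⟨h, { exact := (ShortComplex.mk f g h).exact_of_f_is_kernel
          (KernelFork.IsLimit.ofι f h (fun x hx => (hd _ x hx).choose)
            (fun x hx => (hd _ x hx).choose_spec)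
            (fun x hx m hm => by rw [← cancel_mono f, hm, (hd _ x hx).choose_spec])) }⟩

/-- The complex `K` is spliced from the short exact sequences `0 ⟶ Zⁱ ⟶ Kⁱ ⟶ Zⁱ⁺¹ ⟶ 0`. -/
structure IsSplice (K : CochainComplex C ℤ) (Z : ℤ → C) (f : ∀ i, Z i ⟶ K.X i)
    (g : ∀ i, K.X i ⟶ Z (i + 1)) : Prop where
  isShortExact : ∀ i, IsShortExact (f i) (g i)
  fac : ∀ i, g i ≫ f (i + 1) = K.d i (i + 1)

lemma exists_isSplice {K : CochainComplex C ℤ} (hK : K.Acyclic) :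
    ∃ (Z : ℤ → C) (f : ∀ i, Z i ⟶ K.X i) (g : ∀ i, K.X i ⟶ Z (i + 1)), IsSplice K Z f g := by
  refine ⟨fun i => kernel (K.d i (i + 1)), fun i => kernel.ι _,
    fun i => kernel.lift _ (K.d i (i + 1)) (K.d_comp_d _ _ _), fun i => ?_, fun i => by simp⟩
  have : Epi (kernel.lift (K.d (i + 1) (i + 1 + 1)) (K.d i (i + 1)) (K.d_comp_d _ _ _)) := by
    have := hK (i + 1)
    rw [K.exactAt_iff' i (i + 1) (i + 1 + 1) (by simp) (by simp),
      ShortComplex.exact_iff_epi_kernel_lift] at this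
    exact this
  refine .of_exists_lift (by simp [← cancel_mono (kernel.ι _)]) fun X x hx => ?_
  exact ⟨kernel.lift _ x (by simpa using hx =≫ kernel.ι _), by simp⟩

/-- The complex spliced from short exact sequences `0 ⟶ Zⁱ ⟶ Pⁱ ⟶ Zⁱ⁺¹ ⟶ 0`. -/
noncomputable def splice (Z P : ℤ → C) (f : ∀ i, Z i ⟶ P i) (g : ∀ i, P i ⟶ Z (i + 1))
    (h : ∀ i, IsShortExact (f i) (g i)) : CochainComplex C ℤ :=
  CochainComplex.of P (fun i => g i ≫ f (i + 1)) fun i => by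
    rw [Category.assoc, reassoc_of% (h (i + 1)).zero, zero_comp, comp_zero]

lemma isSplice_splice (Z P : ℤ → C) (f : ∀ i, Z i ⟶ P i) (g : ∀ i, P i ⟶ Z (i + 1))
    (h : ∀ i, IsShortExact (f i) (g i)) : IsSplice (splice Z P f g h) Z f g :=
  ⟨h, fun i => (CochainComplex.of_d P (fun i => g i ≫ f (i + 1)) i).symm⟩

namespace IsSplice

variable {K : CochainComplex C ℤ} {Z : ℤ → C} {f : ∀ i, Z i ⟶ K.X i}
  {g : ∀ i, K.X i ⟶ Z (i + 1)}

lemma acyclic (h : IsSplice K Z f g) : K.Acyclic := by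
  intro j
  obtain ⟨i, rfl⟩ : ∃ i, i + 1 = j := ⟨j - 1, by simp⟩
  rw [K.exactAt_iff' i (i + 1) (i + 1 + 1) (by simp) (by simp),
    ShortComplex.exact_iff_exact_up_to_refinements]
  intro A (x : A ⟶ K.X (i + 1)) (hx : x ≫ K.d _ _ = 0)
  have := (h.isShortExact (i + 1 + 1)).mono
  have := (h.isShortExact i).epi
  obtain ⟨y, rfl⟩ := (h.isShortExact (i + 1)).exists_lift x (by
    rw [← cancel_mono (f (i + 1 + 1)), Category.assoc, h.fac, hx, zero_comp])
  obtain ⟨A', π, _, z, hz⟩ := surjective_up_to_refinements_of_epi (g i) y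
  refine ⟨A', π, inferInstance, z, ?_⟩
  change π ≫ (y ≫ f (i + 1) : A ⟶ K.X (i + 1)) = z ≫ K.d _ _
  rw [← h.fac, reassoc_of% hz]

/-- A cocycle on `K.X (i + 1)` vanishes on `Z (i + 1)`, so it is a morphism out of `Z (i + 1 + 1)`;
it is a coboundary exactly when that morphism extends along `f`. -/
lemma homTo_acyclic_iff (h : IsSplice K Z f g) (X : C) : (homTo K X).Acyclic ↔
    ∀ i (x : Z i ⟶ X), ∃ y : K.X i ⟶ X, f i ≫ y = x := by
  constructor
  · intro hX j x
    obtain ⟨i, rfl⟩ : ∃ i, i + 1 = j := ⟨j - 1, by simp⟩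
    have := (h.isShortExact i).epi
    obtain ⟨y, hy⟩ := (homTo_exactAt_iff K X (i := i - 1) (j := i) (k := i + 1)
      (by simp) (by simp)).1 (hX i) (g i ≫ x) (by
        obtain ⟨k, rfl⟩ : ∃ k, k + 1 = i := ⟨i - 1, by simp⟩
        rw [show k + 1 - 1 = k by simp, ← h.fac, Category.assoc,
          reassoc_of% (h.isShortExact (k + 1)).zero, zero_comp, comp_zero])
    exact ⟨y, by rw [← cancel_epi (g i), reassoc_of% h.fac, hy]⟩
  · intro hX j
    obtain ⟨i, rfl⟩ : ∃ i, i + 1 = j := ⟨j - 1, by simp⟩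
    rw [homTo_exactAt_iff K X (i := i) (j := i + 1) (k := i + 1 + 1) (by simp) (by simp)]
    intro x hx
    have := (h.isShortExact i).epi
    obtain ⟨y, rfl⟩ := (h.isShortExact (i + 1)).exists_desc x (by
      rw [← cancel_epi (g i), reassoc_of% h.fac, hx, comp_zero])
    obtain ⟨z, rfl⟩ := hX _ y
    exact ⟨z, by rw [reassoc_of% h.fac]⟩

lemma homFrom_acyclic_iff (h : IsSplice K Z f g) (X : C) : (homFrom X K).Acyclic ↔
    ∀ i (x : X ⟶ Z (i + 1)), ∃ y : X ⟶ K.X i, y ≫ g i = x := by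
  constructor
  · intro hX i x
    have := (h.isShortExact (i + 1)).mono
    obtain ⟨y, hy⟩ := (homFrom_exactAt_iff K X (i := i) (j := i + 1) (k := i + 1 + 1)
      (by simp) (by simp)).1 (hX (i + 1)) (x ≫ f (i + 1)) (by
        rw [← h.fac, Category.assoc, reassoc_of% (h.isShortExact (i + 1)).zero, zero_comp,
          comp_zero])
    exact ⟨y, by rw [← cancel_mono (f (i + 1)), Category.assoc, h.fac, hy]⟩
  · intro hX j
    obtain ⟨i, rfl⟩ : ∃ i, i + 1 = j := ⟨j - 1, by simp⟩
    rw [homFrom_exactAt_iff K X (i := i) (j := i + 1) (k := i + 1 + 1) (by simp) (by simp)]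
    intro x hx
    have := (h.isShortExact (i + 1 + 1)).mono
    obtain ⟨y, rfl⟩ := (h.isShortExact (i + 1)).exists_lift x (by
      rw [← cancel_mono (f (i + 1 + 1)), Category.assoc, h.fac, hx, zero_comp])
    obtain ⟨z, rfl⟩ := hX _ y
    exact ⟨z, by rw [← h.fac, Category.assoc]⟩

/-- The separate indices allow the literal degrees `-2`, `-1`, `0`. -/
lemma nonempty_cokernel_iso (h : IsSplice K Z f g) (i j k : ℤ) (hij : i + 1 = j) (hjk : j + 1 = k) :
    Nonempty (cokernel (K.d i j) ≅ Z k) := by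
  subst hij hjk
  have := (h.isShortExact i).epi
  rw [← h.fac]
  have := (h.isShortExact (i + 1)).epi
  refine ⟨cokernelEpiComp (g i) (f (i + 1)) ≪≫ ?_⟩
  exact (cokernelIsCokernel _).coconePointUniqueUpToIso (h.isShortExact (i + 1)).2.gIsCokernel

end IsSplice

/-- Gorenstein projective objects are the cokernels in totally acyclic complexes of projectives. -/
lemma exists_complex_iff_gorensteinProjective (W : ObjectProperty C) (M : C) :
    (∃ P : CochainComplex C ℤ, (∀ i, Projective (P.X i)) ∧ P.Acyclic ∧
      (∀ T, W T → (homTo P T).Acyclic) ∧ Nonempty (M ≅ cokernel (P.d (-2) (-1)))) ↔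
    gorensteinProjective W M := by
  constructor
  · rintro ⟨P, hP, hPa, hPW, ⟨e⟩⟩
    obtain ⟨Z, f, g, h⟩ := exists_isSplice hPa
    obtain ⟨e'⟩ := h.nonempty_cokernel_iso (-2) (-1) 0 rfl rfl
    have hf T (hT : W T) := (h.homTo_acyclic_iff T).1 (hPW T hT)
    -- The cycle objects, up to isomorphism, form a Gorenstein class.
    refine ⟨fun X => ∃ i, Nonempty (X ≅ Z i), ⟨?_, ?_⟩, 0, ⟨e ≪≫ e'⟩⟩
    · rintro X ⟨j, ⟨e⟩⟩
      obtain ⟨i, rfl⟩ : ∃ i, i + 1 = j := ⟨j - 1, by simp⟩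
      exact ⟨Z i, ⟨i, ⟨Iso.refl _⟩⟩, _, _, _, (h.isShortExact i).comp_iso e.symm, hP i,
        fun T hT => hf T hT i⟩
    · rintro X ⟨i, ⟨e⟩⟩
      refine ⟨Z (i + 1), ⟨i + 1, ⟨Iso.refl _⟩⟩, _, _, _, (h.isShortExact i).iso_comp e, hP i,
        fun T hT x => ?_⟩
      obtain ⟨y, hy⟩ := hf T hT i (e.inv ≫ x)
      exact ⟨y, by simp [hy]⟩
  · rintro ⟨G, hG, hM⟩
    obtain ⟨Z, rfl, hZ⟩ := exists_int_seq (ProjectiveStep W) G hG.syzygy hG.cosyzygy M hM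
    choose P f g h hP hW using hZ
    have hs := isSplice_splice Z P f g h
    obtain ⟨e⟩ := hs.nonempty_cokernel_iso (-2) (-1) 0 rfl rfl
    exact ⟨_, hP, hs.acyclic, fun T hT => (hs.homTo_acyclic_iff T).2 fun i => hW i T hT, ⟨e.symm⟩⟩

/-- Gorenstein injective objects are the Gorenstein projective objects of the opposite category. -/
lemma exists_complex_iff_gorensteinProjective_op (W : ObjectProperty C) (M : C) :
    (∃ I : CochainComplex C ℤ, (∀ i, Injective (I.X i)) ∧ I.Acyclic ∧
      (∀ T, W T → (homFrom T I).Acyclic) ∧ Nonempty (M ≅ cokernel (I.d (-2) (-1)))) ↔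
    gorensteinProjective W.op (op M) := by
  constructor
  · rintro ⟨P, hP, hPa, hPW, ⟨e⟩⟩
    obtain ⟨Z, f, g, h⟩ := exists_isSplice hPa
    obtain ⟨e'⟩ := h.nonempty_cokernel_iso (-2) (-1) 0 rfl rfl
    have hg T (hT : W T) := (h.homFrom_acyclic_iff T).1 (hPW T hT)
    refine ⟨fun X => ∃ i, Nonempty (X.unop ≅ Z i), ⟨?_, ?_⟩, 0, ⟨e ≪≫ e'⟩⟩
    · rintro X ⟨i, ⟨e⟩⟩
      refine ⟨op (Z (i + 1)), ⟨i + 1, ⟨Iso.refl _⟩⟩, op (P.X i), _, _,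
        ((h.isShortExact i).iso_comp e).op, inferInstance, fun T hT x => ?_⟩
      obtain ⟨y, hy⟩ := hg T.unop hT i x.unop
      exact ⟨y.op, Quiver.Hom.unop_inj hy⟩
    · rintro X ⟨j, ⟨e⟩⟩
      obtain ⟨i, rfl⟩ : ∃ i, i + 1 = j := ⟨j - 1, by simp⟩
      refine ⟨op (Z i), ⟨i, ⟨Iso.refl _⟩⟩, op (P.X i), _, _,
        ((h.isShortExact i).comp_iso e.symm).op, inferInstance, fun T hT x => ?_⟩
      obtain ⟨y, hy⟩ := hg T.unop hT i (x.unop ≫ e.hom)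
      exact ⟨y.op, Quiver.Hom.unop_inj (by simp [reassoc_of% hy])⟩
  · rintro ⟨G, hG, hM⟩
    -- Steps are read backwards, since passing to the opposite category reverses the complex;
    -- syzygies and cosyzygies change places.
    obtain ⟨Z, hZ₀, hZ⟩ := exists_int_seq (fun X Y => ProjectiveStep W.op Y X) G
      hG.cosyzygy hG.syzygy (op M) hM
    obtain rfl : (Z 0).unop = M := by rw [hZ₀]
    choose P f g h hP hW using hZ
    have hs := isSplice_splice (fun i => (Z i).unop) (fun i => (P i).unop) (fun i => (g i).unop)
      (fun i => (f i).unop) (fun i => (h i).unop)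
    obtain ⟨e⟩ := hs.nonempty_cokernel_iso (-2) (-1) 0 rfl rfl
    refine ⟨_, fun i => (inferInstance : Injective (P i).unop), hs.acyclic,
      fun T hT => (hs.homFrom_acyclic_iff T).2 fun i x => ?_, ⟨e.symm⟩⟩
    obtain ⟨y, hy⟩ := hW i (op T) hT x.op
    exact ⟨y.unop, Quiver.Hom.op_inj hy⟩

end Splice

/-! ### Constructing proper resolutions, and independence of the choice -/

section ProperResolutions

variable {C : Type w} [Category.{v} C] [Abelian C] {F : ObjectProperty C}

namespace ProperLeftResolution

variable {M : C}

/-- The augmented complex `⋯ ⟶ G₁ ⟶ G₀ ⟶ M`. -/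
abbrev augmented (P : ProperLeftResolution F M) : ChainComplex C ℕ :=
  P.complex.augment P.π P.d_π

/-- The proper left resolution spliced from short exact sequences
`0 ⟶ Zₙ₊₁ ⟶ Xₙ ⟶ Zₙ ⟶ 0`. -/
lemma exists_of_isShortExact {E : ObjectProperty C} (Z X : ℕ → C) (f : ∀ n, Z (n + 1) ⟶ X n)
    (g : ∀ n, X n ⟶ Z n) (h : ∀ n, IsShortExact (f n) (g n)) (hX : ∀ n, F (X n))
    (hF : ∀ n Y, F Y → ∀ y : Y ⟶ Z n, ∃ z : Y ⟶ X n, z ≫ g n = y)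
    (hE : ∀ n Y, E Y → ∀ y : Z (n + 1) ⟶ Y, ∃ z : X n ⟶ Y, f n ≫ z = y) :
    ∃ P : ProperLeftResolution F (Z 0), ∀ Y, E Y → (homTo P.augmented Y).Acyclic := by
  let K : ChainComplex C ℕ := ChainComplex.of X (fun n => g (n + 1) ≫ f n) fun n => by
    rw [Category.assoc, reassoc_of% (h (n + 1)).zero, zero_comp, comp_zero]
  have hd (n) : K.d (n + 1) n = g (n + 1) ≫ f n := ChainComplex.of_d X (fun n => g (n + 1) ≫ f n) n
  have hπ : K.d 1 0 ≫ g 0 = 0 := by rw [hd, Category.assoc, (h 0).zero, comp_zero]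
  have hf n := (h n).mono
  have hg n := (h n).epi
  have hprev (n : ℕ) : (ComplexShape.down ℕ).prev n = n + 1 := by simp
  have hnext (n : ℕ) : (ComplexShape.down ℕ).next (n + 1) = n := by simp
  have hnext₀ : (ComplexShape.down ℕ).next 0 = 0 := ChainComplex.next_nat_zero
  refine ⟨⟨K, g 0, hπ, hX, fun Y hY => ?_⟩, fun Y hY => ?_⟩
  · rintro (_ | _ | n)
    · exact (homFrom_exactAt_iff (K.augment (g 0) hπ) Y (hprev 0) hnext₀).2 fun x _ => hF 0 Y hY x
    · refine (homFrom_exactAt_iff (K.augment (g 0) hπ) Y (hprev 1) (hnext 0)).2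
        fun (x : Y ⟶ X 0) (hx : x ≫ g 0 = 0) => ?_
      obtain ⟨y, rfl⟩ := (h 0).exists_lift x hx
      obtain ⟨z, rfl⟩ := hF 1 Y hY y
      exact ⟨z, by simp [hd]⟩
    · refine (homFrom_exactAt_iff (K.augment (g 0) hπ) Y (hprev (n + 2)) (hnext (n + 1))).2
        fun (x : Y ⟶ X (n + 1)) (hx : x ≫ K.d (n + 1) n = 0) => ?_
      obtain ⟨y, rfl⟩ := (h (n + 1)).exists_lift x (by
        rw [← cancel_mono (f n), Category.assoc, ← hd, hx, zero_comp])
      obtain ⟨z, rfl⟩ := hF (n + 2) Y hY y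
      exact ⟨z, by simp [hd]⟩
  · rintro (_ | _ | n)
    · refine (homTo_exactAt_iff (K.augment (g 0) hπ) Y (hprev 0) hnext₀).2
        fun (x : Z 0 ⟶ Y) (hx : g 0 ≫ x = 0) => ⟨0, ?_⟩
      exact comp_zero.trans ((cancel_epi (g 0)).1 (hx.trans comp_zero.symm)).symm
    · refine (homTo_exactAt_iff (K.augment (g 0) hπ) Y (hprev 1) (hnext 0)).2
        fun (x : X 0 ⟶ Y) (hx : K.d 1 0 ≫ x = 0) => ?_
      exact (h 0).exists_desc x (by rw [← cancel_epi (g 1), ← reassoc_of% hd, hx, comp_zero])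
    · refine (homTo_exactAt_iff (K.augment (g 0) hπ) Y (hprev (n + 2)) (hnext (n + 1))).2
        fun (x : X (n + 1) ⟶ Y) (hx : K.d (n + 2) (n + 1) ≫ x = 0) => ?_
      obtain ⟨y, rfl⟩ := (h (n + 1)).exists_desc x (by
        rw [← cancel_epi (g (n + 2)), ← reassoc_of% hd, hx, comp_zero])
      obtain ⟨z, rfl⟩ := hE n Y hY y
      exact ⟨z, by
        change K.d (n + 1) n ≫ z = _
        rw [hd, Category.assoc]⟩

/-- Acyclicity of `Hom(-, Y)` does not depend on the choice of the proper left resolution. -/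
lemma homTo_acyclic (P Q : ProperLeftResolution F M) (Y : C)
    (h : (homTo P.augmented Y).Acyclic) : (homTo Q.augmented Y).Acyclic := by
  let a := Q.lift P (𝟙 M)
  let b := P.lift Q (𝟙 M)
  have ha : a.f 0 ≫ P.π = Q.π := by simpa using Q.lift_π P (𝟙 M)
  have hb : b.f 0 ≫ Q.π = P.π := by simpa using P.lift_π Q (𝟙 M)
  -- Both sides lift the identity of `M`.
  obtain ⟨H⟩ := Q.nonempty_homotopy Q (𝟙 Q.complex) (a ≫ b) (by simp [ha, hb])
  have hprev (n : ℕ) : (ComplexShape.down ℕ).prev n = n + 1 := by simp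
  have hnext (n : ℕ) : (ComplexShape.down ℕ).next (n + 1) = n := by simp
  have hnext₀ : (ComplexShape.down ℕ).next 0 = 0 := ChainComplex.next_nat_zero
  have H₀ : 𝟙 (Q.complex.X 0) = H.hom 0 1 ≫ Q.complex.d 1 0 + a.f 0 ≫ b.f 0 := by
    simpa [prevD_eq H.hom (show (ComplexShape.down ℕ).Rel 1 0 by simp)] using H.comm 0
  have Hs (n : ℕ) : 𝟙 (Q.complex.X (n + 1)) = Q.complex.d (n + 1) n ≫ H.hom n (n + 1) +
      H.hom (n + 1) (n + 2) ≫ Q.complex.d (n + 2) (n + 1) + a.f (n + 1) ≫ b.f (n + 1) := by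
    simpa [dNext_eq H.hom (show (ComplexShape.down ℕ).Rel (n + 1) n by simp),
      prevD_eq H.hom (show (ComplexShape.down ℕ).Rel (n + 2) (n + 1) by simp)] using H.comm (n + 1)
  rintro (_ | _ | n)
  · refine (homTo_exactAt_iff Q.augmented Y (hprev 0) hnext₀).2
      fun (x : M ⟶ Y) (hx : Q.π ≫ x = 0) => ?_
    obtain ⟨y, hy⟩ := (homTo_exactAt_iff P.augmented Y (hprev 0) hnext₀).1 (h 0) x (by
      change P.π ≫ x = 0
      rw [← hb, Category.assoc, hx, comp_zero])
    exact ⟨y, hy⟩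
  · refine (homTo_exactAt_iff Q.augmented Y (hprev 1) (hnext 0)).2
      fun (x : Q.complex.X 0 ⟶ Y) (hx : Q.complex.d 1 0 ≫ x = 0) => ?_
    obtain ⟨(y : M ⟶ Y), (hy : P.π ≫ y = _)⟩ :=
      (homTo_exactAt_iff P.augmented Y (hprev 1) (hnext 0)).1 (h 1) (b.f 0 ≫ x) (by
        change P.complex.d 1 0 ≫ b.f 0 ≫ x = 0
        rw [← b.comm_assoc, hx, comp_zero])
    refine ⟨y, ?_⟩
    change Q.π ≫ y = x
    rw [← ha, Category.assoc, hy]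
    conv_rhs => rw [← Category.id_comp x, H₀]
    simp [hx]
  · refine (homTo_exactAt_iff Q.augmented Y (hprev (n + 2)) (hnext (n + 1))).2
      fun (x : Q.complex.X (n + 1) ⟶ Y) (hx : Q.complex.d (n + 2) (n + 1) ≫ x = 0) => ?_
    obtain ⟨(y : P.complex.X n ⟶ Y), (hy : P.complex.d (n + 1) n ≫ y = _)⟩ :=
      (homTo_exactAt_iff P.augmented Y (hprev (n + 2)) (hnext (n + 1))).1
        (h (n + 2)) (b.f (n + 1) ≫ x) (by
          change P.complex.d (n + 2) (n + 1) ≫ b.f (n + 1) ≫ x = 0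
          rw [← b.comm_assoc, hx, comp_zero])
    -- Apply the homotopy identity `Hs` to the cocycle `x`: the middle term dies, and the two others
    -- are coboundaries of these summands.
    refine ⟨a.f n ≫ y + H.hom n (n + 1) ≫ x, ?_⟩
    change Q.complex.d (n + 1) n ≫ (a.f n ≫ y + H.hom n (n + 1) ≫ x) = x
    conv_rhs => rw [← Category.id_comp x, Hs]
    simp [hx, ← a.comm_assoc, hy, add_comm]

end ProperLeftResolution

namespace ProperRightResolution

variable {N : C}

/-- The augmented complex `N ⟶ G⁰ ⟶ G¹ ⟶ ⋯`. -/
abbrev augmented (P : ProperRightResolution F N) : CochainComplex C ℕ :=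
  P.complex.augment P.ι P.ι_d

/-- The proper right resolution spliced from short exact sequences
`0 ⟶ Zⁿ ⟶ Xⁿ ⟶ Zⁿ⁺¹ ⟶ 0`. -/
lemma exists_of_isShortExact {E : ObjectProperty C} (Z X : ℕ → C) (f : ∀ n, Z n ⟶ X n)
    (g : ∀ n, X n ⟶ Z (n + 1)) (h : ∀ n, IsShortExact (f n) (g n)) (hX : ∀ n, F (X n))
    (hF : ∀ n Y, F Y → ∀ y : Z n ⟶ Y, ∃ z : X n ⟶ Y, f n ≫ z = y)
    (hE : ∀ n Y, E Y → ∀ y : Y ⟶ Z (n + 1), ∃ z : Y ⟶ X n, z ≫ g n = y) :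
    ∃ P : ProperRightResolution F (Z 0), ∀ Y, E Y → (homFrom Y P.augmented).Acyclic := by
  let K : CochainComplex C ℕ := CochainComplex.of X (fun n => g n ≫ f (n + 1)) fun n => by
    rw [Category.assoc, reassoc_of% (h (n + 1)).zero, zero_comp, comp_zero]
  have hd (n) : K.d n (n + 1) = g n ≫ f (n + 1) :=
    CochainComplex.of_d X (fun n => g n ≫ f (n + 1)) n
  have hι : f 0 ≫ K.d 0 1 = 0 := by rw [hd, reassoc_of% (h 0).zero, zero_comp]
  have hf n := (h n).mono
  have hg n := (h n).epi
  have hnext (n : ℕ) : (ComplexShape.up ℕ).next n = n + 1 := by simp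
  have hprev (n : ℕ) : (ComplexShape.up ℕ).prev (n + 1) = n := by simp
  have hprev₀ : (ComplexShape.up ℕ).prev 0 = 0 := CochainComplex.prev_nat_zero
  refine ⟨⟨K, f 0, hι, hX, fun Y hY => ?_⟩, fun Y hY => ?_⟩
  · rintro (_ | _ | n)
    · exact (homTo_exactAt_iff (K.augment (f 0) hι) Y hprev₀ (hnext 0)).2 fun x _ => hF 0 Y hY x
    · refine (homTo_exactAt_iff (K.augment (f 0) hι) Y (hprev 0) (hnext 1)).2
        fun (x : X 0 ⟶ Y) (hx : f 0 ≫ x = 0) => ?_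
      obtain ⟨y, rfl⟩ := (h 0).exists_desc x hx
      obtain ⟨z, rfl⟩ := hF 1 Y hY y
      exact ⟨z, by simp [hd]⟩
    · refine (homTo_exactAt_iff (K.augment (f 0) hι) Y (hprev (n + 1)) (hnext (n + 2))).2
        fun (x : X (n + 1) ⟶ Y) (hx : K.d n (n + 1) ≫ x = 0) => ?_
      obtain ⟨y, rfl⟩ := (h (n + 1)).exists_desc x (by
        rw [← cancel_epi (g n), ← reassoc_of% hd, hx, comp_zero])
      obtain ⟨z, rfl⟩ := hF (n + 2) Y hY y
      exact ⟨z, by simp [hd]⟩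
  · rintro (_ | _ | n)
    · refine (homFrom_exactAt_iff (K.augment (f 0) hι) Y hprev₀ (hnext 0)).2
        fun (x : Y ⟶ Z 0) (hx : x ≫ f 0 = 0) => ⟨0, ?_⟩
      exact zero_comp.trans ((cancel_mono (f 0)).1 (hx.trans zero_comp.symm)).symm
    · refine (homFrom_exactAt_iff (K.augment (f 0) hι) Y (hprev 0) (hnext 1)).2
        fun (x : Y ⟶ X 0) (hx : x ≫ K.d 0 1 = 0) => ?_
      exact (h 0).exists_lift x (by
        rw [← cancel_mono (f 1), Category.assoc, ← hd, hx, zero_comp])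
    · refine (homFrom_exactAt_iff (K.augment (f 0) hι) Y (hprev (n + 1)) (hnext (n + 2))).2
        fun (x : Y ⟶ X (n + 1)) (hx : x ≫ K.d (n + 1) (n + 2) = 0) => ?_
      obtain ⟨y, rfl⟩ := (h (n + 1)).exists_lift x (by
        rw [← cancel_mono (f (n + 2)), Category.assoc, ← hd, hx, zero_comp])
      obtain ⟨z, rfl⟩ := hE n Y hY y
      exact ⟨z, by
        change z ≫ K.d n (n + 1) = _
        rw [hd, Category.assoc]⟩

/-- Acyclicity of `Hom(Y, -)` does not depend on the choice of the proper right resolution. -/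
lemma homFrom_acyclic (P Q : ProperRightResolution F N) (Y : C)
    (h : (homFrom Y P.augmented).Acyclic) : (homFrom Y Q.augmented).Acyclic := by
  let a := P.lift Q (𝟙 N)
  let b := Q.lift P (𝟙 N)
  have ha : P.ι ≫ a.f 0 = Q.ι := by simpa using P.ι_lift Q (𝟙 N)
  have hb : Q.ι ≫ b.f 0 = P.ι := by simpa using Q.ι_lift P (𝟙 N)
  obtain ⟨H⟩ := Q.nonempty_homotopy Q (𝟙 Q.complex) (b ≫ a) (by simp [reassoc_of% hb, ha])
  have hnext (n : ℕ) : (ComplexShape.up ℕ).next n = n + 1 := by simp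
  have hprev (n : ℕ) : (ComplexShape.up ℕ).prev (n + 1) = n := by simp
  have hprev₀ : (ComplexShape.up ℕ).prev 0 = 0 := CochainComplex.prev_nat_zero
  have H₀ : 𝟙 (Q.complex.X 0) = Q.complex.d 0 1 ≫ H.hom 1 0 + b.f 0 ≫ a.f 0 := by
    simpa [dNext_eq H.hom (show (ComplexShape.up ℕ).Rel 0 1 by simp)] using H.comm 0
  have Hs (n : ℕ) : 𝟙 (Q.complex.X (n + 1)) = Q.complex.d (n + 1) (n + 2) ≫ H.hom (n + 2) (n + 1) +
      H.hom (n + 1) n ≫ Q.complex.d n (n + 1) + b.f (n + 1) ≫ a.f (n + 1) := by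
    simpa [dNext_eq H.hom (show (ComplexShape.up ℕ).Rel (n + 1) (n + 2) by simp),
      prevD_eq H.hom (show (ComplexShape.up ℕ).Rel n (n + 1) by simp)] using H.comm (n + 1)
  rintro (_ | _ | n)
  · refine (homFrom_exactAt_iff Q.augmented Y hprev₀ (hnext 0)).2
      fun (x : Y ⟶ N) (hx : x ≫ Q.ι = 0) => ?_
    obtain ⟨y, hy⟩ := (homFrom_exactAt_iff P.augmented Y hprev₀ (hnext 0)).1 (h 0) x (by
      change x ≫ P.ι = 0
      rw [← hb, reassoc_of% hx, zero_comp])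
    exact ⟨y, hy⟩
  · refine (homFrom_exactAt_iff Q.augmented Y (hprev 0) (hnext 1)).2
      fun (x : Y ⟶ Q.complex.X 0) (hx : x ≫ Q.complex.d 0 1 = 0) => ?_
    obtain ⟨(y : Y ⟶ N), (hy : y ≫ P.ι = _)⟩ :=
      (homFrom_exactAt_iff P.augmented Y (hprev 0) (hnext 1)).1 (h 1) (x ≫ b.f 0) (by
        change (x ≫ b.f 0) ≫ P.complex.d 0 1 = 0
        rw [Category.assoc, b.comm, reassoc_of% hx, zero_comp])
    refine ⟨y, ?_⟩
    change y ≫ Q.ι = x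
    rw [← ha, reassoc_of% hy]
    conv_rhs => rw [← Category.comp_id x, H₀]
    simp [reassoc_of% hx]
  · refine (homFrom_exactAt_iff Q.augmented Y (hprev (n + 1)) (hnext (n + 2))).2
      fun (x : Y ⟶ Q.complex.X (n + 1)) (hx : x ≫ Q.complex.d (n + 1) (n + 2) = 0) => ?_
    obtain ⟨(y : Y ⟶ P.complex.X n), (hy : y ≫ P.complex.d n (n + 1) = _)⟩ :=
      (homFrom_exactAt_iff P.augmented Y (hprev (n + 1)) (hnext (n + 2))).1
        (h (n + 2)) (x ≫ b.f (n + 1)) (by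
          change (x ≫ b.f (n + 1)) ≫ P.complex.d (n + 1) (n + 2) = 0
          rw [Category.assoc, b.comm, reassoc_of% hx, zero_comp])
    refine ⟨y ≫ a.f n + x ≫ H.hom (n + 1) n, ?_⟩
    change (y ≫ a.f n + x ≫ H.hom (n + 1) n) ≫ Q.complex.d n (n + 1) = x
    conv_rhs => rw [← Category.comp_id x, Hs]
    simp [reassoc_of% hx, reassoc_of% hy, add_comm]

end ProperRightResolution

end ProperResolutions

/-! ### Isomorphisms on homology from additive relations -/

section HomologyRelation

/-- The cycle `x` represents the homology class `h`. -/
def Represents (S : ShortComplex AddCommGrpCat.{v}) (x : S.X₂) (h : S.homology) : Prop :=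
  ∃ c : S.cycles, S.iCycles c = x ∧ S.homologyπ c = h

namespace Represents

variable {S T : ShortComplex AddCommGrpCat.{v}} {x y : S.X₂} {h k : S.homology}

lemma exists_homology (x : S.X₂) (hx : S.g x = 0) : ∃ h, Represents S x h :=
  ⟨_, S.abCyclesIso.inv ⟨x, hx⟩, S.abCyclesIso_inv_apply_iCycles ⟨x, hx⟩, rfl⟩

lemma exists_cycle (h : S.homology) : ∃ x, Represents S x h := by
  obtain ⟨c, rfl⟩ := (AddCommGrpCat.epi_iff_surjective S.homologyπ).1 inferInstance h
  exact ⟨_, c, rfl, rfl⟩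

lemma g_eq_zero (hx : Represents S x h) : S.g x = 0 := by
  obtain ⟨c, rfl, -⟩ := hx
  rw [← ConcreteCategory.comp_apply, S.iCycles_g]
  rfl

lemma add (hx : Represents S x h) (hy : Represents S y k) : Represents S (x + y) (h + k) := by
  obtain ⟨c, rfl, rfl⟩ := hx
  obtain ⟨d, rfl, rfl⟩ := hy
  exact ⟨c + d, map_add _ _ _, map_add _ _ _⟩

lemma sub (hx : Represents S x h) (hy : Represents S y k) : Represents S (x - y) (h - k) := by
  obtain ⟨c, rfl, rfl⟩ := hx
  obtain ⟨d, rfl, rfl⟩ := hy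
  exact ⟨c - d, map_sub _ _ _, map_sub _ _ _⟩

lemma eq_zero_iff (hx : Represents S x h) : h = 0 ↔ ∃ z, S.f z = x := by
  obtain ⟨c, rfl, rfl⟩ := hx
  have he := (ShortComplex.mk _ _ S.toCycles_comp_homologyπ).exact_of_g_is_cokernel
    S.homologyIsCokernel
  rw [ShortComplex.ab_exact_iff] at he
  constructor
  · intro hc
    obtain ⟨z, hz⟩ := he c hc
    refine ⟨z, ?_⟩
    rw [← hz, ← S.toCycles_i]
    rfl
  · rintro ⟨z, hz⟩
    have : S.toCycles z = c := by
      apply (AddCommGrpCat.mono_iff_injective S.iCycles).1 inferInstance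
      rw [← hz, ← ConcreteCategory.comp_apply, S.toCycles_i]
    rw [← this, ← ConcreteCategory.comp_apply, S.toCycles_comp_homologyπ]
    rfl

lemma map (hx : Represents S x h) (φ : S ⟶ T) :
    Represents T (φ.τ₂ x) (ShortComplex.homologyMap φ h) := by
  obtain ⟨c, rfl, rfl⟩ := hx
  refine ⟨ShortComplex.cyclesMap φ c, ?_, ?_⟩
  · rw [← ConcreteCategory.comp_apply, ← ConcreteCategory.comp_apply,
      ShortComplex.cyclesMap_i]
  · rw [← ConcreteCategory.comp_apply, ← ConcreteCategory.comp_apply,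
      ShortComplex.homologyπ_naturality]

end Represents

/-- An additive relation between the cycles of two complexes which is surjective on both sides and
matches the boundaries induces an isomorphism on homology. -/
lemma exists_homology_iso_of_relation (S T : ShortComplex AddCommGrpCat.{v})
    (r : S.X₂ → T.X₂ → Prop) (hadd : ∀ x y x' y', r x y → r x' y' → r (x + x') (y + y'))
    (hsub : ∀ x y x' y', r x y → r x' y' → r (x - x') (y - y'))
    (hS : ∀ x, S.g x = 0 → ∃ y, T.g y = 0 ∧ r x y)
    (hT : ∀ y, T.g y = 0 → ∃ x, S.g x = 0 ∧ r x y)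
    (hr : ∀ x y, r x y → ((∃ z, S.f z = x) ↔ ∃ z, T.f z = y)) :
    ∃ e : S.homology ≅ T.homology, ∀ x y h k, r x y → Represents S x h → Represents T y k →
      e.hom h = k := by
  have key (h : S.homology) : ∃ k x y, r x y ∧ Represents S x h ∧ Represents T y k := by
    obtain ⟨x, hx⟩ := Represents.exists_cycle h
    obtain ⟨y, hy, hxy⟩ := hS x hx.g_eq_zero
    obtain ⟨k, hk⟩ := Represents.exists_homology y hy
    exact ⟨k, x, y, hxy, hx, hk⟩
  choose e a b hab ha hb using key
  -- The class `k` depends only on `h`: the difference of two related pairs is related, and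
  -- boundaries correspond.
  have he (x y h k) (hxy : r x y) (hx : Represents S x h) (hy : Represents T y k) : e h = k := by
    rw [← sub_eq_zero, ((hb h).sub hy).eq_zero_iff, ← hr _ _ (hsub _ _ _ _ (hab h) hxy),
      ← ((ha h).sub hx).eq_zero_iff, sub_self]
  let φ : S.homology →+ T.homology := AddMonoidHom.mk' e fun h h' =>
    he _ _ _ _ (hadd _ _ _ _ (hab h) (hab h')) ((ha h).add (ha h')) ((hb h).add (hb h'))
  have hφ : Function.Bijective φ := by
    constructor
    · rw [injective_iff_map_eq_zero]
      intro h hh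
      rwa [(ha h).eq_zero_iff, hr _ _ (hab h), ← (hb h).eq_zero_iff]
    · intro k
      obtain ⟨y, hy⟩ := Represents.exists_cycle k
      obtain ⟨x, hx, hxy⟩ := hT y hy.g_eq_zero
      obtain ⟨h, hh⟩ := Represents.exists_homology x hx
      exact ⟨h, he _ _ _ _ hxy hh hy⟩
  exact ⟨(AddEquiv.ofBijective φ hφ).toAddCommGrpIso, he⟩

end HomologyRelation

/-! ### Zigzags in double complexes -/

section DoubleComplex

/-- A first quadrant double complex of abelian groups, with commuting differentials, whose rows and
columns are exact except for the zeroth row and the zeroth column. -/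
structure ExactDoubleComplex where
  A : ℕ → ℕ → Type v
  [inst : ∀ i j, AddCommGroup (A i j)]
  dh : ∀ i j, A i j →+ A (i + 1) j
  dv : ∀ i j, A i j →+ A i (j + 1)
  comm : ∀ i j x, dh i (j + 1) (dv i j x) = dv (i + 1) j (dh i j x)
  dh_dh : ∀ i j x, dh (i + 1) j (dh i j x) = 0
  dv_dv : ∀ i j x, dv i (j + 1) (dv i j x) = 0
  exact_dh : ∀ i j x, dh (i + 1) (j + 1) x = 0 → ∃ y, dh i (j + 1) y = x
  exact_dv : ∀ i j x, dv (i + 1) (j + 1) x = 0 → ∃ y, dv (i + 1) j y = x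
  dh_zero : ∀ j x, dh 0 (j + 1) x = 0 → x = 0
  dv_zero : ∀ i x, dv (i + 1) 0 x = 0 → x = 0

namespace ExactDoubleComplex

attribute [instance] ExactDoubleComplex.inst

variable (D : ExactDoubleComplex.{v})

/-- The transposed double complex. -/
def transpose : ExactDoubleComplex.{v} where
  A i j := D.A j i
  dh i j := D.dv j i
  dv i j := D.dh j i
  comm i j x := (D.comm j i x).symm
  dh_dh i j := D.dv_dv j i
  dv_dv i j := D.dh_dh j i
  exact_dh i j := D.exact_dv j i
  exact_dv i j := D.exact_dh j i
  dh_zero := D.dv_zero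
  dv_zero := D.dh_zero

/-- The elements `x` of the zeroth row and `y` of the zeroth column are linked by a zigzag. -/
def Zigzag (n : ℕ) (x : D.A 0 (n + 1)) (y : D.A (n + 1) 0) : Prop :=
  ∃ z : ∀ i j, D.A i j, z 0 (n + 1) = x ∧ z (n + 1) 0 = y ∧
    ∀ i j, i + j = n → D.dh i (j + 1) (z i (j + 1)) = D.dv (i + 1) j (z (i + 1) j)

variable {D} {n : ℕ} {x x' : D.A 0 (n + 1)} {y y' : D.A (n + 1) 0}

lemma Zigzag.transpose (h : D.Zigzag n x y) : D.transpose.Zigzag n y x := by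
  obtain ⟨z, hx, hy, hz⟩ := h
  exact ⟨fun i j => z j i, hy, hx, fun i j hij => (hz j i (by lia)).symm⟩

lemma Zigzag.add (h : D.Zigzag n x y) (h' : D.Zigzag n x' y') :
    D.Zigzag n (x + x') (y + y') := by
  obtain ⟨z, rfl, rfl, hz⟩ := h
  obtain ⟨z', rfl, rfl, hz'⟩ := h'
  exact ⟨fun i j => z i j + z' i j, rfl, rfl, fun i j hij => by
    rw [map_add, map_add, hz i j hij, hz' i j hij]⟩

lemma Zigzag.sub (h : D.Zigzag n x y) (h' : D.Zigzag n x' y') :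
    D.Zigzag n (x - x') (y - y') := by
  obtain ⟨z, rfl, rfl, hz⟩ := h
  obtain ⟨z', rfl, rfl, hz'⟩ := h'
  exact ⟨fun i j => z i j - z' i j, rfl, rfl, fun i j hij => by
    rw [map_sub, map_sub, hz i j hij, hz' i j hij]⟩

lemma Zigzag.dv_eq_zero (h : D.Zigzag n x y) : D.dv 0 (n + 1) x = 0 := by
  obtain ⟨z, rfl, -, hz⟩ := h
  apply D.dh_zero
  rw [D.comm, hz 0 n (zero_add n), D.dv_dv]

lemma Zigzag.dh_eq_zero (h : D.Zigzag n x y) : D.dh (n + 1) 0 y = 0 :=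
  h.transpose.dv_eq_zero

/-- Walk along the antidiagonal: `dh` of the current entry is a `dv`-cycle, by the previous zigzag
equation and `dh_dh`, so exactness of `dv` provides the next entry. -/
lemma exists_zigzag (hx : D.dv 0 (n + 1) x = 0) : ∃ y, D.Zigzag n x y := by
  have key (k : ℕ) : ∃ z : ∀ i j, D.A i j, z 0 (n + 1) = x ∧ ∀ i j, i + j = n → i < k →
      D.dh i (j + 1) (z i (j + 1)) = D.dv (i + 1) j (z (i + 1) j) := by
    induction k with
    | zero =>
      exact ⟨fun i => Function.update (fun _ => 0) (n + 1)
        (i.rec (motive := fun i => D.A i (n + 1)) x fun _ _ => 0), by simp, by simp⟩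
    | succ k ih =>
      obtain ⟨z, hzx, hz⟩ := ih
      by_cases hk : k ≤ n
      · obtain ⟨l, rfl⟩ := Nat.exists_eq_add_of_le hk
        have h0 : D.dv (k + 1) (l + 1) (D.dh k (l + 1) (z k (l + 1))) = 0 := by
          rw [← D.comm]
          cases k with
          | zero =>
            have : D.dv 0 (l + 1) (z 0 (l + 1)) = 0 := by
              -- The entries at `0 + l + 1` and `l + 1` have different types, hence the
              -- generalization over `m`.
              have hzx' : ∀ m, 0 + l = m → ∀ x, D.dv 0 (m + 1) x = 0 → z 0 (m + 1) = x →
                  D.dv 0 (l + 1) (z 0 (l + 1)) = 0 := by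
                intro m hm x hx hzx
                obtain rfl : l = m := by lia
                rw [hzx, hx]
              exact hzx' _ rfl x hx hzx
            rw [this, map_zero]
          | succ k => rw [← hz k (l + 1) (by lia) (by lia), D.dh_dh]
        obtain ⟨t, ht⟩ := D.exact_dv _ _ _ h0
        -- Only the entry at `(k + 1, l)` changes; the earlier equations do not involve it.
        refine ⟨fun i => Function.update (z i) l (Function.update (fun i => z i l) (k + 1) t i), ?_,
          fun i j hij hik => ?_⟩
        · dsimp only
          rw [Function.update_of_ne (by lia), hzx]
        · dsimp only
          rcases Nat.lt_succ_iff_lt_or_eq.1 hik with hik | rfl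
          · rw [Function.update_of_ne (by lia), Function.update_of_ne (by lia)]
            exact hz i j hij hik
          · obtain rfl : j = l := by lia
            rw [Function.update_of_ne (by lia), Function.update_self, Function.update_self, ht]
      · exact ⟨z, hzx, fun i j hij hi => hz i j hij (by lia)⟩
  obtain ⟨z, hzx, hz⟩ := key (n + 1)
  exact ⟨_, z, hzx, rfl, fun i j hij => hz i j hij (by lia)⟩

/-- A primitive `w` of `x` is pushed along the antidiagonal to a primitive of `y`: `dh t` and the
zigzag entry have the same `dv`, so they differ by some `dv s`, and `-s` is the next term. The
clause for `n = 0` excludes the corner `Hom(M, N)`, which the unaugmented complexes do not contain.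
-/
lemma Zigzag.exists_dh {x : D.A 0 (n + 1)} {y} (h : D.Zigzag n x y) (w : D.A 0 n)
    (hw : D.dv 0 n w = x) (hn : n = 0 → w = 0) :
    ∃ t : D.A n 0, D.dh n 0 t = y ∧ (n = 0 → t = 0) := by
  obtain ⟨z, rfl, rfl, hz⟩ := h
  have key (i : ℕ) : ∀ j, i + j = n → ∃ t : D.A i j,
      D.dh i (j + 1) (D.dv i j t) = D.dh i (j + 1) (z i (j + 1)) ∧ (n = 0 → t = 0) := by
    induction i with
    | zero =>
      intro j hij
      obtain rfl : j = n := by lia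
      exact ⟨w, by rw [hw], hn⟩
    | succ i ih =>
      intro j hij
      obtain ⟨t, ht, -⟩ := ih (j + 1) (by lia)
      rw [hz i (j + 1) (by lia), D.comm, ← sub_eq_zero, ← map_sub] at ht
      obtain ⟨s, hs⟩ := D.exact_dv _ _ _ ht
      refine ⟨-s, ?_, by lia⟩
      rw [map_neg, hs, map_neg, map_sub, D.dh_dh]
      simp
  obtain ⟨t, ht, ht0⟩ := key n 0 (by lia)
  refine ⟨t, ?_, ht0⟩
  rw [hz n 0 (by lia), D.comm, ← sub_eq_zero, ← map_sub] at ht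
  exact sub_eq_zero.1 (D.dv_zero _ _ ht)

end ExactDoubleComplex

end DoubleComplex

/-! ### Balance of the relative derived functors of `Hom` -/

section Balance

variable {C : Type w} [Category.{v} C] [Abelian C] {F G : ObjectProperty C}

section

variable {M N : C} (L : ProperLeftResolution F M) (U : ProperRightResolution G N)

/-- The double complex `Hom(L, U)` of a left and a right resolution. -/
def homDoubleComplex (hL : ∀ Y, G Y → (homTo L.augmented Y).Acyclic)
    (hU : ∀ X, F X → (homFrom X U.augmented).Acyclic) : ExactDoubleComplex.{v} where
  A i j := L.augmented.X i ⟶ U.augmented.X j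
  dh i j := Preadditive.leftComp (U.augmented.X j) (L.augmented.d (i + 1) i)
  dv i j := Preadditive.rightComp (L.augmented.X i) (U.augmented.d j (j + 1))
  comm i j x := (Category.assoc (L.augmented.d (i + 1) i) x (U.augmented.d j (j + 1))).symm
  dh_dh i j x := by
    change L.augmented.d (i + 2) (i + 1) ≫ L.augmented.d (i + 1) i ≫ x = 0
    rw [L.augmented.d_comp_d_assoc, zero_comp]
  dv_dv i j x := by
    change (x ≫ U.augmented.d j (j + 1)) ≫ U.augmented.d (j + 1) (j + 2) = 0
    rw [Category.assoc, U.augmented.d_comp_d, comp_zero]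
  exact_dh i j := (homTo_exactAt_iff L.augmented (U.complex.X j) (i := i + 2) (j := i + 1) (k := i)
    (by simp) (by simp)).1 (hL _ (U.mem j) (i + 1))
  exact_dv i j := (homFrom_exactAt_iff U.augmented (L.complex.X i) (i := j) (j := j + 1)
    (k := j + 2) (by simp) (by simp)).1 (hU _ (L.mem i) (j + 1))
  dh_zero j x hx := by
    obtain ⟨y, hy⟩ := (homTo_exactAt_iff L.augmented _ (j := 0) (i := 1) (k := 0) (by simp)
      ChainComplex.next_nat_zero).1 (hL _ (U.mem j) 0) x hx
    exact hy.symm.trans zero_comp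
  dv_zero i x hx := by
    obtain ⟨y, hy⟩ := (homFrom_exactAt_iff U.augmented _ (j := 0) (k := 1) (i := 0)
      CochainComplex.prev_nat_zero (by simp)).1 (hU _ (L.mem i) 0) x hx
    exact hy.symm.trans comp_zero

variable {L U} (hL : ∀ Y, G Y → (homTo L.augmented Y).Acyclic)
    (hU : ∀ X, F X → (homFrom X U.augmented).Acyclic)

lemma homFrom_sc_g_eq_zero_iff (n : ℕ) (x : M ⟶ U.complex.X n) :
    ((homFrom M U.complex).sc n).g x = 0 ↔ (homDoubleComplex L U hL hU).dv 0 (n + 1) x = 0 := by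
  have (m : ℕ) (hm : m = n + 1) : (x ≫ U.complex.d n m = 0) ↔ x ≫ U.complex.d n (n + 1) = 0 := by
    subst hm; rfl
  exact this _ (by simp)

lemma homTo_sc_g_eq_zero_iff (n : ℕ) (y : L.complex.X n ⟶ N) :
    ((homTo L.complex N).sc n).g y = 0 ↔ (homDoubleComplex L U hL hU).dh (n + 1) 0 y = 0 := by
  have (m : ℕ) (hm : m = n + 1) : (L.complex.d m n ≫ y = 0) ↔ L.complex.d (n + 1) n ≫ y = 0 := by
    subst hm; rfl
  exact this ((ComplexShape.down ℕ).prev n) (by simp)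

/-- In degree `0` nothing nonzero is a boundary in the unaugmented complex, whereas the double
complex still has the map from `Hom(M, N)`; the side condition on `w` cancels it. -/
lemma homFrom_sc_exists_f_iff (n : ℕ) (x : M ⟶ U.complex.X n) :
    (∃ z, ((homFrom M U.complex).sc n).f z = x) ↔
      ∃ w, (homDoubleComplex L U hL hU).dv 0 n w = x ∧ (n = 0 → w = 0) := by
  change (∃ z : M ⟶ U.complex.X ((ComplexShape.up ℕ).prev n), z ≫ U.complex.d _ n = x) ↔ _
  cases n with
  | zero =>
    rw [CochainComplex.prev_nat_zero]
    constructor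
    · rintro ⟨z, rfl⟩
      rw [U.complex.shape 0 0 (by simp), comp_zero]
      exact ⟨0, map_zero _, fun _ => rfl⟩
    · rintro ⟨w, rfl, hw⟩
      exact ⟨0, by rw [hw rfl, map_zero]; exact zero_comp⟩
  | succ n =>
    rw [CochainComplex.prev_nat_succ]
    exact ⟨fun ⟨z, hz⟩ => ⟨z, hz, by simp⟩, fun ⟨z, hz, _⟩ => ⟨z, hz⟩⟩

lemma homTo_sc_exists_f_iff (n : ℕ) (y : L.complex.X n ⟶ N) :
    (∃ z, ((homTo L.complex N).sc n).f z = y) ↔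
      ∃ w, (homDoubleComplex L U hL hU).dh n 0 w = y ∧ (n = 0 → w = 0) := by
  change (∃ z : L.complex.X ((ComplexShape.down ℕ).next n) ⟶ N, L.complex.d n _ ≫ z = y) ↔ _
  cases n with
  | zero =>
    rw [ChainComplex.next_nat_zero]
    constructor
    · rintro ⟨z, rfl⟩
      rw [L.complex.shape 0 0 (by simp), zero_comp]
      exact ⟨0, map_zero _, fun _ => rfl⟩
    · rintro ⟨w, rfl, hw⟩
      exact ⟨0, by rw [hw rfl, map_zero]; exact comp_zero⟩
  | succ n =>
    rw [ChainComplex.next_nat_succ]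
    exact ⟨fun ⟨z, hz⟩ => ⟨z, hz, by simp⟩, fun ⟨z, hz, _⟩ => ⟨z, hz⟩⟩

/-- The two ways of computing the relative derived functors of `Hom` agree. -/
lemma exists_homology_iso_of_zigzag (n : ℕ) :
    ∃ e : (homFrom M U.complex).homology n ≅ (homTo L.complex N).homology n,
      ∀ (x : M ⟶ U.complex.X n) (y : L.complex.X n ⟶ N) h k,
        (homDoubleComplex L U hL hU).Zigzag n x y →
        Represents ((homFrom M U.complex).sc n) x h →
        Represents ((homTo L.complex N).sc n) y k → e.hom h = k := by
  refine exists_homology_iso_of_relation ((homFrom M U.complex).sc n) ((homTo L.complex N).sc n)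
    (fun x y => (homDoubleComplex L U hL hU).Zigzag n x y)
    (fun _ _ _ _ h h' => h.add h') (fun _ _ _ _ h h' => h.sub h') (fun x hx => ?_)
    (fun y hy => ?_) fun x y h => ?_
  · obtain ⟨y, h⟩ := ExactDoubleComplex.exists_zigzag
      ((homFrom_sc_g_eq_zero_iff hL hU n x).1 hx)
    exact ⟨y, (homTo_sc_g_eq_zero_iff hL hU n y).2 h.dh_eq_zero, h⟩
  · obtain ⟨x, h⟩ := ExactDoubleComplex.exists_zigzag
      (D := (homDoubleComplex L U hL hU).transpose) ((homTo_sc_g_eq_zero_iff hL hU n y).1 hy)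
    exact ⟨x, (homFrom_sc_g_eq_zero_iff hL hU n x).2 h.dh_eq_zero, h.transpose⟩
  · refine (homFrom_sc_exists_f_iff hL hU n x).trans
      (Iff.trans ?_ (homTo_sc_exists_f_iff hL hU n y).symm)
    exact ⟨fun ⟨w, hw, hn⟩ => h.exists_dh w hw hn, fun ⟨w, hw, hn⟩ => h.transpose.exists_dh w hw hn⟩

end

section

variable {M M' N N' : C} {L : ProperLeftResolution F M} {L' : ProperLeftResolution F M'}
  {U : ProperRightResolution G N} {U' : ProperRightResolution G N'}

/-- Zigzags are transported by chain maps of resolutions. -/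
lemma zigzag_map (hL : ∀ Y, G Y → (homTo L.augmented Y).Acyclic)
    (hU : ∀ X, F X → (homFrom X U.augmented).Acyclic)
    (hL' : ∀ Y, G Y → (homTo L'.augmented Y).Acyclic)
    (hU' : ∀ X, F X → (homFrom X U'.augmented).Acyclic)
    (f : M' ⟶ M) (a : L'.complex ⟶ L.complex) (ha : a.f 0 ≫ L.π = L'.π ≫ f)
    (g : N ⟶ N') (b : U.complex ⟶ U'.complex) (hb : U.ι ≫ b.f 0 = g ≫ U'.ι)
    {n : ℕ} {x : M ⟶ U.complex.X n} {y : L.complex.X n ⟶ N}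
    (h : (homDoubleComplex L U hL hU).Zigzag n x y) :
    (homDoubleComplex L' U' hL' hU').Zigzag n ((f ≫ x) ≫ b.f n) (a.f n ≫ y ≫ g) := by
  obtain ⟨(z : ∀ i j, L.augmented.X i ⟶ U.augmented.X j), rfl, rfl, hz⟩ := h
  let α : ∀ i, L'.augmented.X i ⟶ L.augmented.X i := fun i => match i with
    | 0 => f
    | i + 1 => a.f i
  let β : ∀ i, U.augmented.X i ⟶ U'.augmented.X i := fun i => match i with
    | 0 => g
    | i + 1 => b.f i
  have hα (i : ℕ) : L'.augmented.d (i + 1) i ≫ α i = α (i + 1) ≫ L.augmented.d (i + 1) i := by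
    cases i with
    | zero => exact ha.symm
    | succ i => exact (a.comm (i + 1) i).symm
  have hβ (i : ℕ) : β i ≫ U'.augmented.d i (i + 1) = U.augmented.d i (i + 1) ≫ β (i + 1) := by
    cases i with
    | zero => exact hb.symm
    | succ i => exact b.comm i (i + 1)
  refine ⟨fun i j => α i ≫ z i j ≫ β j, (Category.assoc _ _ _).symm, rfl, fun i j hij => ?_⟩
  have hz' : L.augmented.d (i + 1) i ≫ z i (j + 1) = z (i + 1) j ≫ U.augmented.d j (j + 1) :=
    hz i j hij
  change L'.augmented.d (i + 1) i ≫ α i ≫ z i (j + 1) ≫ β (j + 1) =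
    (α (i + 1) ≫ z (i + 1) j ≫ β j) ≫ U'.augmented.d j (j + 1)
  rw [reassoc_of% hα i, reassoc_of% hz', ← hβ, Category.assoc, Category.assoc]

/-- A zigzag starting at a cycle of class `h` maps to a zigzag linking representatives of the two
images to be compared, and `e'` is determined by zigzags. -/
lemma homologyMap_comp_of_zigzag (hL : ∀ Y, G Y → (homTo L.augmented Y).Acyclic)
    (hU : ∀ X, F X → (homFrom X U.augmented).Acyclic)
    (hL' : ∀ Y, G Y → (homTo L'.augmented Y).Acyclic)
    (hU' : ∀ X, F X → (homFrom X U'.augmented).Acyclic) (n : ℕ)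
    (e : (homFrom M U.complex).homology n ≅ (homTo L.complex N).homology n)
    (he : ∀ (x : M ⟶ U.complex.X n) (y : L.complex.X n ⟶ N) h k,
      (homDoubleComplex L U hL hU).Zigzag n x y →
      Represents ((homFrom M U.complex).sc n) x h →
      Represents ((homTo L.complex N).sc n) y k → e.hom h = k)
    (e' : (homFrom M' U'.complex).homology n ≅ (homTo L'.complex N').homology n)
    (he' : ∀ (x : M' ⟶ U'.complex.X n) (y : L'.complex.X n ⟶ N') h k,
      (homDoubleComplex L' U' hL' hU').Zigzag n x y →
      Represents ((homFrom M' U'.complex).sc n) x h →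
      Represents ((homTo L'.complex N').sc n) y k → e'.hom h = k)
    (f : M' ⟶ M) (a : L'.complex ⟶ L.complex) (ha : a.f 0 ≫ L.π = L'.π ≫ f)
    (g : N ⟶ N') (b : U.complex ⟶ U'.complex) (hb : U.ι ≫ b.f 0 = g ≫ U'.ι) :
    HomologicalComplex.homologyMap (homFromMap f b) n ≫ e'.hom =
      e.hom ≫ HomologicalComplex.homologyMap (homToMap a g) n := by
  ext h
  obtain ⟨x, hx⟩ := Represents.exists_cycle h
  obtain ⟨y, hxy⟩ := ExactDoubleComplex.exists_zigzag
    ((homFrom_sc_g_eq_zero_iff hL hU n x).1 hx.g_eq_zero)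
  obtain ⟨k, hk⟩ := Represents.exists_homology (S := (homTo L.complex N).sc n) y
    ((homTo_sc_g_eq_zero_iff hL hU n y).2 hxy.dh_eq_zero)
  obtain rfl := he x y h k hxy hx hk
  refine he' _ _ _ _ (zigzag_map hL hU hL' hU' f a ha g b hb hxy)
    (hx.map ((HomologicalComplex.shortComplexFunctor _ _ n).map (homFromMap f b)))
    (hk.map ((HomologicalComplex.shortComplexFunctor _ _ n).map (homToMap a g)))

end

/-- Balance: if the left resolutions stay exact under `Hom(-, Y)` for `Y` in `G`, and the right
resolutions stay exact under `Hom(X, -)` for `X` in `F`, then the two relative derived functors of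
`Hom` are naturally isomorphic. -/
theorem nonempty_extRight_iso_extLeft (P : ObjectProperty (LeftRes F))
    (Q : ObjectProperty (RightRes G))
    (hP : ∀ L, P L → ∀ Y, G Y → (homTo L.res.augmented Y).Acyclic)
    (hQ : ∀ U, Q U → ∀ X, F X → (homFrom X U.res.augmented).Acyclic) (n : ℕ) :
    Nonempty ((P.ι ⋙ LeftRes.forget F).op.prod Q.ι ⋙ extRight G n ≅
      P.ι.op.prod (Q.ι ⋙ RightRes.forget G) ⋙ extLeft F n) := by
  choose e he using fun p : P.FullSubcategoryᵒᵖ × Q.FullSubcategory =>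
    exists_homology_iso_of_zigzag (hP _ p.1.unop.2) (hQ _ p.2.2) n
  refine ⟨NatIso.ofComponents e fun {p q} φ => ?_⟩
  exact homologyMap_comp_of_zigzag _ _ _ _ n (e p) (he p) (e q) (he q) φ.1.unop.hom _
    (q.1.unop.1.res.lift_π p.1.unop.1.res φ.1.unop.hom) φ.2.hom _
    (p.2.1.res.ι_lift q.2.1.res φ.2.hom)

end Balance

/-! ### Bounded exact complexes as finite resolutions -/

section FiniteResolution

variable {C : Type w} [Category.{v} C] [Abelian C]

lemma hasFiniteResolution_of_acyclic {G : ObjectProperty C} (hG₀ : ∀ X, IsZero X → G X)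
    (K : ChainComplex C ℕ) (hK : K.Acyclic) (hG : ∀ i, G (K.X (i + 1))) (n : ℕ)
    (hn : ∀ i, n < i → IsZero (K.X i)) : HasFiniteResolution G (K.X 0) := by
  -- Downward induction on `i`, with `k = n - i`; at `i = n` the kernel is a subobject of the zero
  -- object `K.X (n + 1)`.
  have key (k : ℕ) : ∀ i, i + k = n → HasFiniteResolution G (kernel (K.d (i + 1) i)) := by
    induction k with
    | zero =>
      intro i hi
      exact .of (hG₀ _ ((hn (i + 1) (by lia)).of_mono (kernel.ι _)))
    | succ k ih =>
      intro i hi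
      have hd : K.d (i + 2) (i + 1) ≫ K.d (i + 1) i = 0 := K.d_comp_d _ _ _
      have : Epi (kernel.lift _ _ hd) := by
        have := hK (i + 1)
        rwa [K.exactAt_iff' (i + 2) (i + 1) i (by simp) (by simp),
          ShortComplex.exact_iff_epi_kernel_lift] at this
      refine .step (kernel.ι (K.d (i + 2) (i + 1))) (kernel.lift _ _ hd)
        (.of_exists_lift (by simp [← cancel_mono (kernel.ι _)]) fun X x hx => ?_) (hG _)
        (ih (i + 1) (by lia))
      exact ⟨kernel.lift _ x (by simpa using hx =≫ kernel.ι _), by simp⟩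
  have : Epi (K.d 1 0) := by
    have := hK 0
    rwa [K.exactAt_iff' 1 0 0 (by simp) ChainComplex.next_nat_zero,
      ShortComplex.exact_iff_epi _ (K.shape 0 0 (by simp))] at this
  exact .step (kernel.ι (K.d 1 0)) (K.d 1 0)
    (.of_exists_lift (kernel.condition _) fun X x hx => ⟨kernel.lift _ x hx, by simp⟩) (hG 0)
    (key n 0 (zero_add n))

end FiniteResolution

/-! ### Projective modules are weak flat -/

section Tensor

variable {R : Type u} [Ring R]

open TensorProduct

lemma BalancedTensor.map_tmul {N N' : Type u} (M : Type u) [AddCommGroup N] [Module Rᵐᵒᵖ N]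
    [AddCommGroup N'] [Module Rᵐᵒᵖ N'] [AddCommGroup M] [Module R M] (f : N →ₗ[Rᵐᵒᵖ] N')
    (n : N) (m : M) :
    BalancedTensor.map M f (QuotientAddGroup.mk (n ⊗ₜ[ℤ] m)) =
      QuotientAddGroup.mk (f n ⊗ₜ[ℤ] m) := rfl

lemma BalancedTensor.smul_tmul {N M : Type u} [AddCommGroup N] [Module Rᵐᵒᵖ N]
    [AddCommGroup M] [Module R M] (n : N) (r : R) (m : M) :
    (QuotientAddGroup.mk ((MulOpposite.op r • n) ⊗ₜ[ℤ] m) : BalancedTensor R N M) =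
      QuotientAddGroup.mk (n ⊗ₜ[ℤ] (r • m)) := by
  rw [← sub_eq_zero]
  exact (QuotientAddGroup.eq_zero_iff _).2 (AddSubgroup.subset_closure ⟨n, r, m, rfl⟩)

/-- A dual basis `s` of `P` embeds `N ⊗_R P` in a direct sum of copies of `N`. -/
noncomputable def BalancedTensor.toFinsupp (N : Type u) {P : Type u} [AddCommGroup N]
    [Module Rᵐᵒᵖ N] [AddCommGroup P] [Module R P] (s : P →ₗ[R] (P →₀ R)) :
    BalancedTensor R N P →+ (P →₀ N) :=
  QuotientAddGroup.lift _ (TensorProduct.liftAddHom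
    (AddMonoidHom.mk' (fun n => (Finsupp.mapRange.addMonoidHom
        (AddMonoidHom.mk' (fun r : R => MulOpposite.op r • n) fun a b => by
          rw [MulOpposite.op_add, add_smul])).comp s.toAddMonoidHom) fun n n' => by
      ext p q
      simp)
    fun z n p => by
      ext q
      simp [mul_smul, Int.cast_smul_eq_zsmul]) (by
    rw [balancedRelations, AddSubgroup.closure_le]
    rintro _ ⟨n, r, p, rfl⟩
    rw [SetLike.mem_coe, AddMonoidHom.mem_ker, map_sub, sub_eq_zero]
    ext q
    simp [mul_smul])

lemma BalancedTensor.toFinsupp_tmul {N P : Type u} [AddCommGroup N] [Module Rᵐᵒᵖ N]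
    [AddCommGroup P] [Module R P] (s : P →ₗ[R] (P →₀ R)) (n : N) (p q : P) :
    BalancedTensor.toFinsupp N s (QuotientAddGroup.mk (n ⊗ₜ[ℤ] p)) q =
      MulOpposite.op (s p q) • n := by
  simp [toFinsupp]

/-- The map from a direct sum of copies of `N` to `N ⊗_R P` given by a family of elements. -/
noncomputable def BalancedTensor.ofFinsupp (R : Type u) [Ring R] (N P : Type u) [AddCommGroup N]
    [Module Rᵐᵒᵖ N] [AddCommGroup P] [Module R P] : (P →₀ N) →+ BalancedTensor R N P :=
  Finsupp.liftAddHom fun q => (QuotientAddGroup.mk' _).comp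
    (AddMonoidHom.mk' (fun n => n ⊗ₜ[ℤ] q) fun n n' => TensorProduct.add_tmul n n' q)

lemma BalancedTensor.ofFinsupp_single {N P : Type u} [AddCommGroup N]
    [Module Rᵐᵒᵖ N] [AddCommGroup P] [Module R P] (n : N) (q : P) :
    BalancedTensor.ofFinsupp R N P (Finsupp.single q n) = QuotientAddGroup.mk (n ⊗ₜ[ℤ] q) := by
  simp [ofFinsupp]

/-- Expanding `p` in the dual basis moves its coefficients across the tensor sign. Thus `N ⊗_R P` is
a retract, naturally in `N`, of a direct sum of copies of `N`. -/
lemma BalancedTensor.ofFinsupp_toFinsupp {N P : Type u} [AddCommGroup N] [Module Rᵐᵒᵖ N]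
    [AddCommGroup P] [Module R P] (s : P →ₗ[R] (P →₀ R))
    (hs : ∀ p, Finsupp.linearCombination R id (s p) = p) (t : BalancedTensor R N P) :
    BalancedTensor.ofFinsupp R N P (BalancedTensor.toFinsupp N s t) = t := by
  suffices (BalancedTensor.ofFinsupp R N P).comp (BalancedTensor.toFinsupp N s) =
    AddMonoidHom.id _ from DFunLike.congr_fun this t
  refine BalancedTensor.hom_ext fun n p => ?_
  have key (a : P →₀ R) : BalancedTensor.ofFinsupp R N P (a.mapRange
      (fun r => MulOpposite.op r • n) (by simp)) =
      QuotientAddGroup.mk (n ⊗ₜ[ℤ] Finsupp.linearCombination R id a) := by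
    induction a using Finsupp.induction_linear with
    | zero => simp
    | add a b ha hb =>
      rw [Finsupp.mapRange_add (fun r r' => by rw [MulOpposite.op_add, add_smul]), map_add, ha, hb,
        map_add, TensorProduct.tmul_add]
      rfl
    | single q r =>
      rw [Finsupp.mapRange_single, ofFinsupp_single, smul_tmul, Finsupp.linearCombination_single,
        id]
  refine Eq.trans ?_ ((key (s p)).trans (by rw [hs]; rfl))
  rfl

lemma BalancedTensor.toFinsupp_map {N N' P : Type u} [AddCommGroup N] [Module Rᵐᵒᵖ N]
    [AddCommGroup N'] [Module Rᵐᵒᵖ N'] [AddCommGroup P] [Module R P] (s : P →ₗ[R] (P →₀ R))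
    (f : N →ₗ[Rᵐᵒᵖ] N') (t : BalancedTensor R N P) (q : P) :
    BalancedTensor.toFinsupp N' s (BalancedTensor.map P f t) q =
      f (BalancedTensor.toFinsupp N s t q) := by
  suffices (BalancedTensor.toFinsupp N' s).comp (BalancedTensor.map P f) =
      (Finsupp.mapRange.addMonoidHom f.toAddMonoidHom).comp (BalancedTensor.toFinsupp N s) from
    DFunLike.congr_fun (DFunLike.congr_fun this t) q
  refine BalancedTensor.hom_ext fun n p => Finsupp.ext fun q => ?_
  simp [map_tmul, toFinsupp_tmul]

lemma BalancedTensor.map_ofFinsupp {N N' P : Type u} [AddCommGroup N] [Module Rᵐᵒᵖ N]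
    [AddCommGroup N'] [Module Rᵐᵒᵖ N'] [AddCommGroup P] [Module R P]
    (f : N →ₗ[Rᵐᵒᵖ] N') (t : P →₀ N) :
    BalancedTensor.map P f (BalancedTensor.ofFinsupp R N P t) =
      BalancedTensor.ofFinsupp R N' P (t.mapRange f (map_zero f)) := by
  induction t using Finsupp.induction_linear with
  | zero => simp
  | add t t' h h' => rw [map_add, map_add, h, h', Finsupp.mapRange_add (map_add f), map_add]
  | single q n => rw [ofFinsupp_single, map_tmul, Finsupp.mapRange_single, ofFinsupp_single]

/-- Tensoring with a projective module is exact. -/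
lemma tensorFunctor_map_exact (P : ModuleCat.{u} R) [Projective P]
    {S : ShortComplex (ModuleCat.{u} Rᵐᵒᵖ)} (hS : S.Exact) :
    (S.map (tensorFunctor P)).Exact := by
  have : Module.Projective R P := (IsProjective.iff_projective P).2 inferInstance
  obtain ⟨s, hs⟩ := Module.projective_def.1 this
  rw [ShortComplex.ab_exact_iff]
  classical
  intro (t : BalancedTensor R S.X₂ P) (ht : BalancedTensor.map P S.g.hom t = 0)
  rw [ShortComplex.moduleCat_exact_iff] at hS
  choose! r hr using hS
  -- Preimages are chosen coordinate by coordinate; the value `0` is imposed at zero coordinates,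
  -- where `r` could be nonzero, to keep the support finite.
  let u : P →₀ S.X₁ := Finsupp.onFinset (BalancedTensor.toFinsupp S.X₂ s t).support
    (fun q => if BalancedTensor.toFinsupp S.X₂ s t q = 0 then 0 else
      r (BalancedTensor.toFinsupp S.X₂ s t q)) (by simp; tauto)
  refine ⟨BalancedTensor.ofFinsupp R S.X₁ P u, (BalancedTensor.map_ofFinsupp S.f.hom u).trans ?_⟩
  rw [← BalancedTensor.ofFinsupp_toFinsupp s hs t]
  congr 1
  ext q
  have := BalancedTensor.toFinsupp_map s S.g.hom t q
  rw [ht, map_zero, Finsupp.zero_apply] at this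
  by_cases hq : BalancedTensor.toFinsupp S.X₂ s t q = 0
  · simp [u, hq]
  · simpa [u, hq] using hr _ this.symm

lemma projective_le_weakFlat (R : Type u) [Ring R] :
    (fun X => Projective X : ObjectProperty (ModuleCat.{u} R)) ≤ weakFlat R := by
  intro P (hP : Projective P) N _
  let Q := projectiveResolution N
  refine IsZero.of_iso ?_ (Q.isoLeftDerivedObj (tensorFunctor P) 1)
  exact ShortComplex.exact_iff_isZero_homology _ |>.1
    (tensorFunctor_map_exact P (Q.complex_exactAt_succ 0))

end Tensor

/-! ### Application to Gorenstein weak projective and injective modules -/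

section Main

lemma injective_le_weakInjective (R : Type u) [Ring R] :
    (fun X => Projective X : ObjectProperty (ModuleCat.{u} R)ᵒᵖ) ≤ (weakInjective R).op := by
  intro I (hI : Projective I) N _
  exact subsingleton_ext_injective N I.unop

variable {R : Type u} [Ring R]

lemma gorensteinWeakProjective_iff (M : ModuleCat.{u} R) :
    gorensteinWeakProjective R M ↔ gorensteinProjective (weakFlat R) M :=
  exists_complex_iff_gorensteinProjective _ _

lemma gorensteinWeakInjective_iff (M : ModuleCat.{u} R) :
    gorensteinWeakInjective R M ↔ gorensteinProjective (weakInjective R).op (op M) :=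
  exists_complex_iff_gorensteinProjective_op _ _

lemma gorensteinProjective_weakFlat (R : Type u) [Ring R] :
    gorensteinProjective (weakFlat R) = gorensteinWeakProjective R :=
  funext fun M => propext (gorensteinWeakProjective_iff M).symm

lemma gorensteinProjective_weakInjective_op (R : Type u) [Ring R] :
    gorensteinProjective (weakInjective R).op = (gorensteinWeakInjective R).op :=
  funext fun M => propext (gorensteinWeakInjective_iff M.unop).symm

lemma hasFiniteResolution_of_gwpd_lt_top {M : ModuleCat.{u} R} (hM : gwpd M < ⊤) :
    HasFiniteResolution (gorensteinProjective (weakFlat R)) M := by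
  simp only [gwpd, iInf_lt_iff] at hM
  obtain ⟨n, ⟨G, f, hf, hG, hGn, hz⟩, -⟩ := hM
  have h₀ (X : ModuleCat.{u} R) (hX : IsZero X) : gorensteinProjective (weakFlat R) X :=
    projective_le_gorensteinProjective _ _ hX.projective
  -- Augmenting puts `M` in degree `0` and shifts the resolution up, hence `n + 1`.
  refine hasFiniteResolution_of_acyclic h₀ (G.augment f hf) hG (fun i => ?_) (n + 1) fun i hi => ?_
  · by_cases hi : i ≤ n
    · exact (gorensteinWeakProjective_iff _).1 (hGn i hi)
    · exact h₀ _ (hz i (by lia))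
  · obtain ⟨i, rfl⟩ : ∃ j, j + 1 = i := ⟨i - 1, by lia⟩
    exact hz i (by lia)

lemma hasFiniteResolution_of_gwid_lt_top {N : ModuleCat.{u} R} (hN : gwid N < ⊤) :
    HasFiniteResolution (gorensteinProjective (weakInjective R).op) (op N) := by
  simp only [gwid, iInf_lt_iff] at hN
  obtain ⟨n, ⟨G, f, hf, hG, hGn, hz⟩, -⟩ := hN
  have h₀ (X : (ModuleCat.{u} R)ᵒᵖ) (hX : IsZero X) :
      gorensteinProjective (weakInjective R).op X :=
    projective_le_gorensteinProjective _ _ hX.projective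
  refine hasFiniteResolution_of_acyclic h₀ (G.augment f hf).op hG.op (fun i => ?_) (n + 1)
    fun i hi => ?_
  · by_cases hi : i ≤ n
    · exact (gorensteinWeakInjective_iff _).1 (hGn i hi)
    · exact h₀ _ (hz i (by lia)).op
  · obtain ⟨i, rfl⟩ : ∃ j, j + 1 = i := ⟨i - 1, by lia⟩
    exact (hz i (by lia)).op

/-- Modules of finite Gorenstein weak projective dimension have a proper left resolution which
stays exact under `Hom(-, E)` for all Gorenstein weak injective `E`. -/
lemma exists_properLeftResolution {M : ModuleCat.{u} R} (hM : gwpd M < ⊤) :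
    ∃ P : ProperLeftResolution (gorensteinWeakProjective R) M,
      ∀ Y, gorensteinWeakInjective R Y → (homTo P.augmented Y).Acyclic := by
  obtain ⟨Z, rfl, hZ⟩ := exists_seq_balancedStep (projective_le_weakFlat R)
    (E := gorensteinWeakInjective R) (fun X hX => by
      -- A cosyzygy step in the opposite category is an epimorphism from an injective onto `X` with
      -- Gorenstein weak injective kernel.
      obtain ⟨Y, hY, P, f, g, h, hP, -⟩ := (isGorensteinClass_gorensteinProjective _).cosyzygy _
        ((gorensteinWeakInjective_iff X).1 hX)
      exact ⟨Y.unop, P.unop, g.unop, f.unop, h.unop, (gorensteinWeakInjective_iff Y.unop).2 hY,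
        inferInstance⟩) (hasFiniteResolution_of_gwpd_lt_top hM)
  rw [gorensteinProjective_weakFlat] at hZ
  choose X f g h hX hF hE using hZ
  exact ProperLeftResolution.exists_of_isShortExact Z X f g h hX hF hE

/-- Modules of finite Gorenstein weak injective dimension have a proper right resolution which
stays exact under `Hom(P, -)` for all Gorenstein weak projective `P`. -/
lemma exists_properRightResolution {N : ModuleCat.{u} R} (hN : gwid N < ⊤) :
    ∃ P : ProperRightResolution (gorensteinWeakInjective R) N,
      ∀ Y, gorensteinWeakProjective R Y → (homFrom Y P.augmented).Acyclic := by
  obtain ⟨Z, hZ₀, hZ⟩ := exists_seq_balancedStep (injective_le_weakInjective R)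
    (E := (gorensteinWeakProjective R).op) (fun X hX => by
      obtain ⟨Y, hY, P, f, g, h, hP, -⟩ := (isGorensteinClass_gorensteinProjective _).cosyzygy _
        ((gorensteinWeakProjective_iff X.unop).1 hX)
      exact ⟨op Y, op P, g.op, f.op, h.op, (gorensteinWeakProjective_iff Y).2 hY,
        inferInstance⟩) (hasFiniteResolution_of_gwid_lt_top hN)
  obtain rfl : (Z 0).unop = N := by rw [hZ₀]
  rw [gorensteinProjective_weakInjective_op] at hZ
  choose X f g h hX hF hE using hZ
  refine ProperRightResolution.exists_of_isShortExact (fun n => (Z n).unop) (fun n => (X n).unop)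
    (fun n => (g n).unop) (fun n => (f n).unop) (fun n => (h n).unop) hX (fun n Y hY y => ?_)
    fun n Y hY y => ?_
  · obtain ⟨z, hz⟩ := hF n (op Y) hY y.op
    exact ⟨z.unop, Quiver.Hom.op_inj hz⟩
  · obtain ⟨z, hz⟩ := hE n (op Y) hY y.op
    exact ⟨z.unop, Quiver.Hom.op_inj hz⟩

end Main

end GorensteinWeak

open GorensteinWeak in
theorem theorem4 (R : Type u) [Ring R] :
    (∀ M : ModuleCat.{u} R, gwpd M < ⊤ →
      Nonempty (ProperLeftResolution (gorensteinWeakProjective R) M)) ∧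
    (∀ N : ModuleCat.{u} R, gwid N < ⊤ →
      Nonempty (ProperRightResolution (gorensteinWeakInjective R) N)) ∧
    ∀ n : ℕ, Nonempty (extGWI R n ≅ extGWP R n) := by
  refine ⟨fun M hM => ⟨(exists_properLeftResolution hM).choose⟩,
    fun N hN => ⟨(exists_properRightResolution hN).choose⟩, fun n =>
    nonempty_extRight_iso_extLeft _ _ (fun L hL Y hY => ?_) (fun U hU X hX => ?_) n⟩
  · obtain ⟨P, hP⟩ := exists_properLeftResolution hL
    exact P.homTo_acyclic L.res Y (hP Y hY)
  · obtain ⟨P, hP⟩ := exists_properRightResolution hU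
    exact P.homFrom_acyclic U.res X (hP X hX)
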